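/- Let $p$ be a prime number, let $K$ be a field of characteristic $p$, let $K^{\mathrm{ab}}$ be the maximal abelian extension of $K$ inside a separable closure of $K$, and let $G=\mathrm{Gal}(K^{\mathrm{ab}}/K)$ with the Krull topology. Write $W(R)$ for the ring of $p$-typical Witt vectors of a commutative ring $R$, let $V$ be the Verschiebung on $W(R)$, and put $W_n(R)=W(R)/V^nW(R)$ for $n\in\mathbb{Z}_{\ge 1}$ and $W_\infty(R)=W(R)$. The ring $W(R)$ carries the $V$-adic topology, in which the ideals $V^iW(R)$ ($i\ge 0$) form a basis of neighbourhoods of $0$, and $W_n(R)$ carries the quotient topology (which is discrete if $n$ is finite). If $R$ has characteristic $p$, let $F$ be the endomorphism of $W_n(R)$ induced by $x\mapsto x^p$ on $R$, and let $\wp=F-\mathrm{id}:W_n(R)\to W_n(R)$. The group $W_n(K)/\wp W_n(K)$ carries the quotient topology. Quotients of $G$ carry the quotient topology, $G_p=\varprojlim_i G/p^iG$ carries the topology induced from the product, and groups of continuous homomorphisms carry the compact-open topology. Recall that $W_n(\mathbb{F}_p)\cong\mathbb{Z}/p^n\mathbb{Z}$ and $W_\infty(\mathbb{F}_p)\cong\mathbb{Z}_p$.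 Let $n\in\mathbb{Z}_{\ge1}$. Then every element of $W_n(K)$ is of the form $\wp a$ with $a\in W_n(K^{\mathrm{ab}})$, and $$(\ ,\ ):\ G/p^nG\times W_n(K)/\wp W_n(K)\to W_n(\mathbb{F}_p),\qquad (g,\ \wp a \bmod \wp W_n(K))\mapsto ga-a$$ (where $a\in W_n(K^{\mathrm{ab}})$ and $\wp a\in W_n(K)$) is a well-defined bi-additive pairing which is perfect: its left and right kernels are trivial, and the induced maps $$\varphi_1:\ G/p^nG\to \mathrm{Hom}\bigl(W_n(K)/\wp W_n(K),\,W_n(\mathbb{F}_p)\bigr),\qquad g\mapsto\bigl(\wp a\mapsto ga-a\bigr)$$ and $$\varphi_2:\ W_n(K)/\wp W_n(K)\to \mathrm{Hom}_{\mathrm{cont}}\bigl(G/p^nG,\,W_n(\mathbb{F}_p)\bigr),\qquad \wp a\mapsto\bigl(g\mapsto ga-a\bigr)$$ are well-defined isomorphisms of topological groups. Here every group homomorphism $W_n(K)/\wp W_n(K)\to W_n(\mathbb{F}_p)$ is continuous, so that $\mathrm{Hom}=\mathrm{Hom}_{\mathrm{cont}}$ in the target of $\varphi_1$. The same statements hold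 for $n=\infty$ if $G/p^nG$ is replaced by $G_p$; here the value of the pairing at the image in $G_p$ of $g\in G$ and the class of $\wp a$ is $ga-a\in W(\mathbb{F}_p)$, and this determines the pairing. -/

import Mathlib

open scoped IsMulCommutative

noncomputable section

namespace ArtinSchreierWitt

/-! ### Witt vectors of length `n`, for `n` a natural number or `n = ∞` -/

section Witt

variable (p : ℕ) [hp : Fact p.Prime] (n : ℕ∞) (R : Type*) [CommRing R]

/-- The ideal `V^n W(R)` of Witt vectors whose first `n` coefficients vanish (the zero ideal if
`n = ∞`), written as the intersection of the kernels of all truncations to finite length `≤ n`. -/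
def vIdeal : Ideal (WittVector p R) :=
  ⨅ (m : ℕ) (_ : (m : ℕ∞) ≤ n), RingHom.ker (WittVector.truncate (p := p) (R := R) m)

variable {p n R} in
theorem mem_vIdeal {x : WittVector p R} :
    x ∈ vIdeal p n R ↔ ∀ i : ℕ, (i : ℕ∞) < n → x.coeff i = 0 := by
  simp only [vIdeal, Ideal.mem_iInf, WittVector.mem_ker_truncate]
  constructor
  · intro h i hi
    exact h (i + 1) (by exact_mod_cast Order.add_one_le_of_lt hi) i (Nat.lt_succ_self i)
  · intro h m hm i hi
    exact h i (lt_of_lt_of_le (by exact_mod_cast hi) hm)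

theorem vIdeal_natCast (m : ℕ) :
    vIdeal p (m : ℕ∞) R = RingHom.ker (WittVector.truncate (p := p) (R := R) m) := by
  ext x
  rw [mem_vIdeal, WittVector.mem_ker_truncate]
  simp only [Nat.cast_lt]

variable {p R} in
/-- For finite `m` the ideal is the image of the `m`-th iterate of the Verschiebung. -/
theorem mem_vIdeal_natCast_iff (m : ℕ) (x : WittVector p R) :
    x ∈ vIdeal p (m : ℕ∞) R ↔ ∃ y : WittVector p R, x = WittVector.verschiebung^[m] y := by
  simp only [mem_vIdeal, Nat.cast_lt]
  constructor
  · intro h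
    exact ⟨_, WittVector.eq_iterate_verschiebung h⟩
  · rintro ⟨y, rfl⟩ i hi
    exact WittVector.iterate_verschiebung_coeff_eq_zero y hi

theorem vIdeal_top : vIdeal p ⊤ R = ⊥ := by
  simp [vIdeal, TruncatedWittVector.iInf_ker_truncate]

theorem vIdeal_basis : RingSubgroupsBasis
    (fun i : ℕ => (vIdeal p (i : ℕ∞) R).toAddSubgroup) := by
  refine RingSubgroupsBasis.of_comm _ ?_ ?_ ?_
  · intro i j
    refine ⟨max i j, fun x hx => ?_⟩
    have hx' : x ∈ vIdeal p ((max i j : ℕ) : ℕ∞) R := hx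
    rw [mem_vIdeal] at hx'
    constructor
    · change x ∈ vIdeal p (i : ℕ∞) R
      rw [mem_vIdeal]
      exact fun k hk => hx' k (lt_of_lt_of_le hk (by exact_mod_cast le_max_left i j))
    · change x ∈ vIdeal p (j : ℕ∞) R
      rw [mem_vIdeal]
      exact fun k hk => hx' k (lt_of_lt_of_le hk (by exact_mod_cast le_max_right i j))
  · intro i
    refine ⟨i, ?_⟩
    rintro _ ⟨x, hx, y, -, rfl⟩
    exact Ideal.mul_mem_right _ _ hx
  · intro x i
    exact ⟨i, fun y hy => Ideal.mul_mem_left _ _ hy⟩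

/-- The `V`-adic topology on `W(R)`: the ideals `V^i W(R)`, `i = 0, 1, 2, …`, form a basis of
neighbourhoods of `0`. -/
instance vAdicTopology : TopologicalSpace (WittVector p R) :=
  (vIdeal_basis p R).topology

instance : IsTopologicalRing (WittVector p R) :=
  (vIdeal_basis p R).toRingFilterBasis.isTopologicalRing

/-- The ring `W_n(R) = W(R) / V^n W(R)`, where `W_∞(R) = W(R)`; it carries the quotient of the
`V`-adic topology. -/
abbrev WittLen : Type _ := WittVector p R ⧸ vIdeal p n R

/-- `W_m(R)` for finite `m` is the ring of truncated Witt vectors. -/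
def wittLenEquivTruncated (m : ℕ) :
    WittLen p (m : ℕ∞) R ≃+* TruncatedWittVector p m R :=
  (Ideal.quotEquivOfEq (vIdeal_natCast p R m)).trans
    (RingHom.quotientKerEquivOfSurjective (WittVector.truncate_surjective p m R))

/-- `W_∞(R)` is the ring of Witt vectors. -/
def wittLenTopEquiv : WittLen p ⊤ R ≃+* WittVector p R :=
  (Ideal.quotEquivOfEq (vIdeal_top p R)).trans (RingEquiv.quotientBot _)

variable {R} {S : Type*} [CommRing S]

/-- Functoriality of `W_n`: the ring homomorphism `W_n(f)`, acting as `f` on each coefficient. -/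
def wittMap (f : R →+* S) : WittLen p n R →+* WittLen p n S :=
  Ideal.quotientMap (vIdeal p n S) (WittVector.map f) (by
    intro x hx
    rw [mem_vIdeal] at hx
    rw [Ideal.mem_comap, mem_vIdeal]
    intro i hi
    rw [WittVector.map_coeff, hx i hi, map_zero])

variable (R) in
/-- The map `℘ = F - id` on `W_n(R)`, where `R` has characteristic `p` and `F` is induced by
`x ↦ x ^ p` on `R`. -/
def wp [CharP R p] : WittLen p n R →+ WittLen p n R :=
  (wittMap p n (frobenius R p)).toAddMonoidHom - AddMonoidHom.id _

variable (R) in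
/-- The topological group `W_n(R) / ℘ W_n(R)`. -/
abbrev WittModWp [CharP R p] : Type _ := WittLen p n R ⧸ (wp p n R).range

end Witt

/-! ### The maximal abelian extension and quotients of its Galois group -/

section Galois

variable (K Ω : Type*) [Field K] [Field Ω] [Algebra K Ω]

/-- The compositum of all abelian Galois extensions of `K` inside `Ω`. If `Ω` is a separable
closure of `K`, this is the maximal abelian extension of `K`. -/
def maxAbelian : IntermediateField K Ω :=
  ⨆ E : {E : IntermediateField K Ω // IsAbelianGalois K E}, E.1

theorem le_maxAbelian (E : IntermediateField K Ω) (hE : IsAbelianGalois K E) :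
    E ≤ maxAbelian K Ω :=
  le_iSup (fun E : {E : IntermediateField K Ω // IsAbelianGalois K E} => E.1) ⟨E, hE⟩

instance : IsGalois K (maxAbelian K Ω) := by
  have hE (E : {E : IntermediateField K Ω // IsAbelianGalois K E}) : IsAbelianGalois K E.1 := E.2
  have h₁ : Normal K (maxAbelian K Ω) :=
    IntermediateField.normal_iSup K Ω
      (fun E : {E : IntermediateField K Ω // IsAbelianGalois K E} => E.1)
  have h₂ : Algebra.IsSeparable K (maxAbelian K Ω) := by
    unfold maxAbelian
    infer_instance
  exact ⟨⟩

instance : IsAbelianGalois K (maxAbelian K Ω) := by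
  have key (g h : Gal(maxAbelian K Ω/K)) (x : maxAbelian K Ω) : g (h x) = h (g x) := by
    let T : IntermediateField K (maxAbelian K Ω) :=
      { carrier := {y | g (h y) = h (g y)}
        mul_mem' := fun {a b} ha hb => by
          change g (h a) = h (g a) at ha
          change g (h b) = h (g b) at hb
          change g (h (a * b)) = h (g (a * b))
          rw [map_mul, map_mul, map_mul, map_mul, ha, hb]
        add_mem' := fun {a b} ha hb => by
          change g (h a) = h (g a) at ha
          change g (h b) = h (g b) at hb
          change g (h (a + b)) = h (g (a + b))
          rw [map_add, map_add, map_add, map_add, ha, hb]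
        algebraMap_mem' := fun r => by
          change g (h (algebraMap K _ r)) = h (g (algebraMap K _ r))
          rw [h.commutes, g.commutes, h.commutes]
        inv_mem' := fun a ha => by
          change g (h a) = h (g a) at ha
          change g (h a⁻¹) = h (g a⁻¹)
          rw [map_inv₀, map_inv₀, map_inv₀, map_inv₀, ha] }
    have hT : maxAbelian K Ω ≤ T.map (maxAbelian K Ω).val := by
      refine iSup_le ?_
      rintro ⟨E, hE⟩ y hy
      have hEM : E ≤ maxAbelian K Ω := le_maxAbelian K Ω E hE
      let _ : Algebra E (maxAbelian K Ω) := (IntermediateField.inclusion hEM).toRingHom.toAlgebra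
      have : IsScalarTower K E (maxAbelian K Ω) := IsScalarTower.of_algebraMap_eq fun r => rfl
      refine ⟨⟨y, hEM hy⟩, ?_, rfl⟩
      change g (h (algebraMap E (maxAbelian K Ω) ⟨y, hy⟩)) =
        h (g (algebraMap E (maxAbelian K Ω) ⟨y, hy⟩))
      rw [← AlgEquiv.restrictNormal_commutes h, ← AlgEquiv.restrictNormal_commutes g,
        ← AlgEquiv.restrictNormal_commutes g, ← AlgEquiv.restrictNormal_commutes h]
      congr 1
      exact DFunLike.congr_fun (mul_comm (g.restrictNormal E) (h.restrictNormal E)) _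
    obtain ⟨y, hy, hyx⟩ := hT x.2
    have hxy : y = x := Subtype.ext hyx
    rw [← hxy]
    exact hy
  exact { is_comm := ⟨fun g h => AlgEquiv.ext fun x => key g h x⟩ }

instance (p : ℕ) [CharP K p] : CharP (maxAbelian K Ω) p :=
  IntermediateField.charP _ p

end Galois

section Completion

variable (p : ℕ) (G : Type*) [CommGroup G]

/-- The subgroup `p^n G` of an abelian group `G`, in multiplicative notation: the `p^n`-th
powers. -/
def powSubgroup (n : ℕ) : Subgroup G := (powMonoidHom (p ^ n) : G →* G).range

theorem powSubgroup_anti {i j : ℕ} (h : i ≤ j) :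
    powSubgroup p G j ≤ (powSubgroup p G i).comap (MonoidHom.id G) := by
  rintro _ ⟨g, rfl⟩
  obtain ⟨k, rfl⟩ := Nat.exists_eq_add_of_le h
  exact ⟨g ^ p ^ k, by simp [← pow_mul, pow_add, mul_comm]⟩

/-- The natural map `G / p^j G → G / p^i G` for `i ≤ j`. -/
def powTransition {i j : ℕ} (h : i ≤ j) : G ⧸ powSubgroup p G j →* G ⧸ powSubgroup p G i :=
  QuotientGroup.map _ _ (MonoidHom.id G) (powSubgroup_anti p G h)

/-- The inverse limit `G_p = lim_i G / p^i G`, as a subgroup of the product. If `G` is a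
topological group, it carries the topology induced from the product of the quotient
topologies. -/
def proPQuotient : Subgroup (∀ i : ℕ, G ⧸ powSubgroup p G i) where
  carrier := {x | ∀ (i j : ℕ) (h : i ≤ j), powTransition p G h (x j) = x i}
  mul_mem' := fun hx hy i j h => by simp [hx i j h, hy i j h]
  one_mem' := fun i j h => by simp
  inv_mem' := fun hx i j h => by simp [hx i j h]

/-- The natural map `G → G_p`. -/
def toProPQuotient : G →* proPQuotient p G where
  toFun g := ⟨fun _ => (g : G ⧸ _), fun _ _ _ => rfl⟩
  map_one' := rfl
  map_mul' _ _ := rfl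

end Completion

/-! ### Perfect pairings of topological groups -/

/-- A pairing `H × M → A` of topological groups (`H` written multiplicatively, `M` and `A`
additively) which is perfect: it is bi-additive, it is non-degenerate on both sides, and the two
maps `H → Hom(M, A)` and `M → Hom_cont(H, A)` that it induces are isomorphisms of topological
groups, where the groups of continuous homomorphisms have the compact-open topology. The target
`Hom(M, A)` of the first map is the group of all homomorphisms, all of which are continuous. -/
structure IsPerfectTopPairing {H M A : Type*} [Group H] [TopologicalSpace H]
    [AddCommGroup M] [TopologicalSpace M]
    [AddCommGroup A] [TopologicalSpace A] [IsTopologicalAddGroup A]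
    (B : H → M → A) : Prop where
  mul_left : ∀ (x y : H) (m : M), B (x * y) m = B x m + B y m
  add_right : ∀ (x : H) (m m' : M), B x (m + m') = B x m + B x m'
  left_nondegenerate : ∀ x : H, (∀ m : M, B x m = 0) → x = 1
  right_nondegenerate : ∀ m : M, (∀ x : H, B x m = 0) → m = 0
  continuous_of_hom : ∀ f : M →+ A, Continuous f
  left_equiv : ∃ φ₁ : Additive H ≃ₜ+ (M →ₜ+ A), ∀ (x : H) (m : M), φ₁ (Additive.ofMul x) m = B x m
  right_equiv : ∃ φ₂ : M ≃ₜ+ (Additive H →ₜ+ A),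
    ∀ (x : H) (m : M), φ₂ m (Additive.ofMul x) = B x m

/-! ### The pairing `(g, ℘ a) ↦ g a - a` -/

/-- Let `π : Gal(L/K) → H` be a homomorphism. The map `B : H × W_n(K)/℘ W_n(K) → W_n(𝔽_p)` is
given by `(π g, ℘ a mod ℘ W_n(K)) ↦ g a - a`, for all `g` in `Gal(L/K)` and all `a` in `W_n(L)`
with `℘ a` in `W_n(K)`; the difference `g a - a` is compared with the value of `B` through the map
`W_n(𝔽_p) → W_n(L)` induced by `𝔽_p → L`. -/
def IsWittPairing (p : ℕ) [Fact p.Prime] (n : ℕ∞) (K L : Type*) [Field K] [CharP K p]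
    [Field L] [CharP L p] [Algebra K L] {H : Type*} [Group H] (π : Gal(L/K) →* H)
    (B : H → WittModWp p n K → WittLen p n (ZMod p)) : Prop :=
  ∀ (g : Gal(L/K)) (a : WittLen p n L) (c : WittLen p n K),
    wp p n L a = wittMap p n (algebraMap K L) c →
      wittMap p n (ZMod.castHom (dvd_refl p) L) (B (π g) (c : WittModWp p n K)) =
        wittMap p n (g : L →+* L) a - a

/-- The pairing `(g, ℘ a) ↦ g a - a` is well defined on `H × W_n(K)/℘ W_n(K)`, with values in
`W_n(𝔽_p)` (that is, every element of `W_n(K)` has the form `℘ a` with `a` in `W_n(L)`, and there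
is exactly one map with the values prescribed by the formula), and it is perfect. -/
def HasPerfectWittPairing (p : ℕ) [Fact p.Prime] (n : ℕ∞) (K L : Type*) [Field K] [CharP K p]
    [Field L] [CharP L p] [Algebra K L] {H : Type*} [Group H] [TopologicalSpace H]
    (π : Gal(L/K) →* H) : Prop :=
  (∀ c : WittLen p n K, ∃ a : WittLen p n L, wp p n L a = wittMap p n (algebraMap K L) c) ∧
  ∃ B : H → WittModWp p n K → WittLen p n (ZMod p),
    (IsWittPairing p n K L π B ∧ ∀ B', IsWittPairing p n K L π B' → B' = B) ∧
    IsPerfectTopPairing B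

end ArtinSchreierWitt

end

/-! Write L = K^ab and G = Gal(L/K). All lengths n are handled together by working in W itself: if c
in W(K) and a in W(L) satisfy ℘a = c, then ga - a is killed by ℘, so it lies in W(𝔽_p), and D g c =
ga - a is bi-additive (`IsWittCocycle`). The pairing of length n is D modulo V^n.

Solutions a exist over the separable closure, because ℘a = c reduces to equations b^p - b = r, one
coefficient at a time. Since g moves a by a constant, automorphisms commute on the coefficients of
a, so a already lies in W(L).

Right kernel: if every g fixes a modulo V^n, then a descends to K modulo V^n, so c lies in ℘W(K) +
V^n W(K). Every continuous character G → W_n(𝔽_p) has the form g ↦ D g c, by additive Hilbert 90 on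
successive coefficients (`exists_galMap_sub_eq_of_character`). Left kernel: an element outside the
closed subgroup p^n G is detected by a continuous character of order dividing p^n, and this
character comes from some c (`mem_powSubgroup_iff`). For finite n, surjectivity of φ₁ is finite
duality by counting plus compactness of G (`exists_eq_of_nondegenerate`); n = ∞ follows by
compactness again.

Topology: F^k V^k = p^k and F ≡ id modulo ℘, so V^k W(K) lies in p^k W(K) + ℘W(K). Hence all
homomorphisms respect the V-filtrations, uniformly. They are therefore continuous, the pairing is
jointly continuous, and `isPerfectTopPairing_of_basis` applies. -/

noncomputable section

namespace ArtinSchreierWitt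

/-! ### Congruences modulo V^n and the map ℘ on W(R). -/

section WittCongruence

variable {p : ℕ} [hp : Fact p.Prime] {n : ℕ∞} {R S : Type*} [CommRing R] [CommRing S]

/-- Subtraction is not coefficientwise, but truncation is a ring homomorphism that determines the
first coefficients. -/
theorem sub_mem_vIdeal {x y : WittVector p R} :
    x - y ∈ vIdeal p n R ↔ ∀ i : ℕ, (i : ℕ∞) < n → x.coeff i = y.coeff i := by
  have h (m : ℕ) : x - y ∈ RingHom.ker (WittVector.truncate (p := p) (R := R) m) ↔
      ∀ i < m, x.coeff i = y.coeff i := by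
    rw [RingHom.sub_mem_ker_iff]
    constructor
    · intro h i hi
      have := congrArg (fun t => TruncatedWittVector.coeff ⟨i, hi⟩ t) h
      simpa [WittVector.coeff_truncate] using this
    · intro h
      ext i
      rw [WittVector.coeff_truncate, WittVector.coeff_truncate, h i i.2]
  simp only [vIdeal, Ideal.mem_iInf, h]
  constructor
  · intro h i hi
    exact h (i + 1) (by exact_mod_cast Order.add_one_le_of_lt hi) i (Nat.lt_succ_self i)
  · intro h m hm i hi
    exact h i (lt_of_lt_of_le (by exact_mod_cast hi) hm)

theorem vIdeal_anti {m n : ℕ∞} (h : m ≤ n) : vIdeal p n R ≤ vIdeal p m R := by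
  intro x hx
  rw [mem_vIdeal] at hx ⊢
  exact fun i hi => hx i (hi.trans_le h)

theorem mem_vIdeal_top {x : WittVector p R} : x ∈ vIdeal p ⊤ R ↔ x = 0 := by
  rw [vIdeal_top, Ideal.mem_bot]

theorem mem_vIdeal_of_forall_natCast {x : WittVector p R}
    (h : ∀ k : ℕ, (k : ℕ∞) ≤ n → x ∈ vIdeal p k R) : x ∈ vIdeal p n R := by
  rw [mem_vIdeal]
  intro i hi
  exact mem_vIdeal.1 (h (i + 1) (by exact_mod_cast Order.add_one_le_of_lt hi)) i
    (by exact_mod_cast Nat.lt_succ_self i)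

theorem mem_vIdeal_zero (x : WittVector p R) : x ∈ vIdeal p ((0 : ℕ) : ℕ∞) R := by
  rw [mem_vIdeal]
  intro i hi
  simp at hi

theorem map_mem_vIdeal (f : R →+* S) {x : WittVector p R} (hx : x ∈ vIdeal p n R) :
    WittVector.map f x ∈ vIdeal p n S := by
  rw [mem_vIdeal] at hx ⊢
  intro i hi
  rw [WittVector.map_coeff, hx i hi, map_zero]

theorem mem_vIdeal_of_map_mem {f : R →+* S} (hf : Function.Injective f) {x : WittVector p R}
    (hx : WittVector.map f x ∈ vIdeal p n S) : x ∈ vIdeal p n R := by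
  rw [mem_vIdeal] at hx ⊢
  intro i hi
  have := hx i hi
  rw [WittVector.map_coeff] at this
  exact hf (this.trans (map_zero f).symm)

/-- V is additive and the zeroth coefficient is a ring homomorphism. This linearises every inductive
step below: V^k/V^(k+1) is the additive group of R. -/
theorem coeff_sub_of_mem_vIdeal {k : ℕ} {x y : WittVector p R} (hx : x ∈ vIdeal p k R)
    (hy : y ∈ vIdeal p k R) : (x - y).coeff k = x.coeff k - y.coeff k := by
  obtain ⟨x, rfl⟩ := (mem_vIdeal_natCast_iff k x).1 hx
  obtain ⟨y, rfl⟩ := (mem_vIdeal_natCast_iff k y).1 hy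
  have h : WittVector.verschiebung^[k] x - WittVector.verschiebung^[k] y =
      WittVector.verschiebung^[k] (x - y) := (iterate_map_sub WittVector.verschiebung k x y).symm
  rw [h]
  have h0 (z : WittVector p R) : (WittVector.verschiebung^[k] z).coeff k = z.coeff 0 := by
    simpa using WittVector.iterate_verschiebung_coeff z k 0
  rw [h0, h0, h0]
  exact map_sub (WittVector.constantCoeff (p := p) (R := R)) x y

theorem coeff_add_of_mem_vIdeal {k : ℕ} {x y : WittVector p R} (hx : x ∈ vIdeal p k R)
    (hy : y ∈ vIdeal p k R) : (x + y).coeff k = x.coeff k + y.coeff k := by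
  have := coeff_sub_of_mem_vIdeal (add_mem hx hy) hy
  rw [add_sub_cancel_right] at this
  rw [this, sub_add_cancel]

theorem mem_vIdeal_succ {k : ℕ} {x : WittVector p R} :
    x ∈ vIdeal p ((k + 1 : ℕ) : ℕ∞) R ↔ x ∈ vIdeal p k R ∧ x.coeff k = 0 := by
  simp only [mem_vIdeal, Nat.cast_lt, Nat.lt_succ_iff_lt_or_eq]
  constructor
  · exact fun h => ⟨fun i hi => h i (Or.inl hi), h k (Or.inr rfl)⟩
  · rintro ⟨h, h'⟩ i (hi | rfl)
    exacts [h i hi, h']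

theorem exists_mem_vIdeal_coeff_eq (p : ℕ) [Fact p.Prime] (k : ℕ) (r : R) :
    ∃ x ∈ vIdeal p k R, x.coeff k = r := by
  refine ⟨WittVector.verschiebung^[k] (WittVector.teichmuller p r),
    (mem_vIdeal_natCast_iff k _).2 ⟨_, rfl⟩, ?_⟩
  have := WittVector.iterate_verschiebung_coeff (WittVector.teichmuller p r) k 0
  rw [zero_add] at this
  rw [this, WittVector.teichmuller_coeff_zero]

/-- Successive approximation in `W(R)`. -/
theorem exists_of_approximation (P : ℕ → WittVector p R → Prop)
    (h0 : ∃ x, P 0 x)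
    (hcongr : ∀ (k : ℕ) x y, y - x ∈ vIdeal p k R → P k x → P k y)
    (hstep : ∀ (k : ℕ) x, ((k + 1 : ℕ) : ℕ∞) ≤ n → P k x →
      ∃ y, y - x ∈ vIdeal p k R ∧ P (k + 1) y) :
    ∃ x, ∀ k : ℕ, (k : ℕ∞) ≤ n → P k x := by
  classical
  -- The step is made total, keeping x when it does not apply, so that the sequence is defined for
  -- all k even if n is finite.
  have hstep' (k : ℕ) (x : WittVector p R) : ∃ y, y - x ∈ vIdeal p k R ∧
      (((k + 1 : ℕ) : ℕ∞) ≤ n → P k x → P (k + 1) y) := by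
    by_cases h : ((k + 1 : ℕ) : ℕ∞) ≤ n ∧ P k x
    · obtain ⟨y, hy, hy'⟩ := hstep k x h.1 h.2
      exact ⟨y, hy, fun _ _ => hy'⟩
    · exact ⟨x, by simp, fun h1 h2 => (h ⟨h1, h2⟩).elim⟩
  choose s hs hs' using hstep'
  obtain ⟨x0, hx0⟩ := h0
  let u : ℕ → WittVector p R := fun k => Nat.rec x0 (fun k x => s k x) k
  have hu (k : ℕ) : u (k + 1) = s k (u k) := rfl
  have hP (k : ℕ) (hk : (k : ℕ∞) ≤ n) : P k (u k) := by
    induction k with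
    | zero => exact hx0
    | succ k ih =>
      rw [hu]
      exact hs' k (u k) hk (ih (le_trans (by exact_mod_cast Nat.le_succ k) hk))
  have hcoeff (i j : ℕ) : (u (i + 1 + j)).coeff i = (u (i + 1)).coeff i := by
    induction j with
    | zero => rfl
    | succ j ih =>
      rw [← ih, ← add_assoc, hu]
      exact sub_mem_vIdeal.1 (hs _ _) i (by exact_mod_cast (by omega))
  -- The i-th coefficient no longer changes from stage i + 1 on, so it is read off there.
  refine ⟨WittVector.mk p fun i => (u (i + 1)).coeff i, fun k hk => hcongr k _ _ ?_ (hP k hk)⟩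
  rw [sub_mem_vIdeal]
  intro i hi
  obtain ⟨j, rfl⟩ := Nat.exists_eq_add_of_le (Nat.succ_le_of_lt (by exact_mod_cast hi : i < k))
  rw [WittVector.coeff_mk]
  exact (hcoeff i j).symm

/-- The map `℘ = F - id` on `W(R)`. -/
def wittWp (p : ℕ) [Fact p.Prime] (R : Type*) [CommRing R] [CharP R p] :
    WittVector p R →+ WittVector p R :=
  (WittVector.map (frobenius R p)).toAddMonoidHom - AddMonoidHom.id _

variable [CharP R p] [CharP S p]

theorem wittWp_apply (x : WittVector p R) :
    wittWp p R x = WittVector.map (frobenius R p) x - x := rfl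

theorem map_wittWp (f : R →+* S) (x : WittVector p R) :
    WittVector.map f (wittWp p R x) = wittWp p S (WittVector.map f x) := by
  rw [wittWp_apply, wittWp_apply, map_sub]
  congr 1
  ext i
  simp only [WittVector.map_coeff, frobenius_def, map_pow]

theorem wittWp_mem_vIdeal {x : WittVector p R} (hx : x ∈ vIdeal p n R) :
    wittWp p R x ∈ vIdeal p n R :=
  sub_mem (map_mem_vIdeal _ hx) hx

theorem coeff_wittWp_of_mem_vIdeal {k : ℕ} {x : WittVector p R} (hx : x ∈ vIdeal p k R) :
    (wittWp p R x).coeff k = x.coeff k ^ p - x.coeff k := by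
  rw [wittWp_apply, coeff_sub_of_mem_vIdeal (map_mem_vIdeal _ hx) hx, WittVector.map_coeff,
    frobenius_def]

theorem wittWp_mem_vIdeal_iff {x : WittVector p R} :
    wittWp p R x ∈ vIdeal p n R ↔ ∀ i : ℕ, (i : ℕ∞) < n → x.coeff i ^ p = x.coeff i := by
  rw [wittWp_apply, sub_mem_vIdeal]
  simp [WittVector.map_coeff, frobenius_def]

theorem wittWp_zmod (x : WittVector p (ZMod p)) : wittWp p (ZMod p) x = 0 := by
  rw [← mem_vIdeal_top, wittWp_mem_vIdeal_iff]
  intro i _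
  exact ZMod.pow_card _

theorem pow_mul_mem_vIdeal (k : ℕ) (x : WittVector p R) :
    (p : WittVector p R) ^ k * x ∈ vIdeal p k R := by
  rw [mem_vIdeal, mul_comm]
  intro i hi
  exact WittVector.mul_pow_charP_coeff_zero x (by exact_mod_cast hi)

theorem frobenius_iterate_sub_mem_range (k : ℕ) (x : WittVector p R) :
    WittVector.frobenius^[k] x - x ∈ (wittWp p R).range := by
  induction k with
  | zero => simp
  | succ k ih =>
    rw [Function.iterate_succ_apply', ← sub_add_sub_cancel _ (WittVector.frobenius^[k] x)]
    refine add_mem ⟨WittVector.frobenius^[k] x, ?_⟩ ih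
    rw [wittWp_apply, WittVector.frobenius_eq_map_frobenius]

/-- Modulo `℘ W(R)`, every element of `V^k W(R)` is divisible by `p^k`. -/
theorem exists_sub_pow_mul_mem_range {k : ℕ} {x : WittVector p R} (hx : x ∈ vIdeal p k R) :
    ∃ y b, x = (p : WittVector p R) ^ k * y + wittWp p R b := by
  obtain ⟨y, rfl⟩ := (mem_vIdeal_natCast_iff k x).1 hx
  obtain ⟨b, hb⟩ := frobenius_iterate_sub_mem_range k (WittVector.verschiebung^[k] y)
  -- F and V commute in characteristic p, and FV = p.
  have h : WittVector.frobenius^[k] (WittVector.verschiebung^[k] y) =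
      (p : WittVector p R) ^ k * y := by
    have hc : Function.Commute (WittVector.frobenius : WittVector p R → _)
        WittVector.verschiebung := fun x => (WittVector.verschiebung_frobenius_comm x).symm
    rw [(hc.iterate_iterate k k) y, WittVector.iterate_verschiebung_iterate_frobenius,
      mul_comm]
  exact ⟨y, -b, by rw [map_neg, hb, h]; ring⟩

end WittCongruence

/-! ### Solutions of ℘a = c and the abelian extensions they generate. -/

section Galois

variable {p : ℕ} [hp : Fact p.Prime] {n : ℕ∞} {K L : Type*} [Field K] [Field L] [Algebra K L]

/-- The action of an automorphism of `L` on `W(L)`. -/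
def galMap (p : ℕ) [Fact p.Prime] (g : Gal(L/K)) : WittVector p L →+* WittVector p L :=
  WittVector.map (g : L →+* L)

@[simp]
theorem coeff_galMap (g : Gal(L/K)) (x : WittVector p L) (i : ℕ) :
    (galMap p g x).coeff i = g (x.coeff i) :=
  WittVector.map_coeff _ _ _

theorem galMap_mul (g h : Gal(L/K)) (x : WittVector p L) :
    galMap p (g * h) x = galMap p g (galMap p h x) := by
  ext i
  simp

theorem galMap_map_algebraMap (g : Gal(L/K)) (x : WittVector p K) :
    galMap p g (WittVector.map (algebraMap K L) x) = WittVector.map (algebraMap K L) x := by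
  ext i
  simp [WittVector.map_coeff]

theorem galMap_mem_vIdeal (g : Gal(L/K)) {x : WittVector p L} (hx : x ∈ vIdeal p n L) :
    galMap p g x ∈ vIdeal p n L :=
  map_mem_vIdeal _ hx

variable [CharP L p]

variable (p L) in
/-- The map `W(𝔽_p) → W(L)`. -/
def constMap : WittVector p (ZMod p) →+* WittVector p L :=
  WittVector.map (ZMod.castHom (dvd_refl p) L)

theorem constMap_injective : Function.Injective (constMap p L) :=
  WittVector.map_injective _ (RingHom.injective _)

theorem coeff_constMap (z : WittVector p (ZMod p)) (i : ℕ) :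
    (constMap p L z).coeff i = ZMod.castHom (dvd_refl p) L (z.coeff i) :=
  WittVector.map_coeff _ _ _

theorem constMap_mem_vIdeal_iff {z : WittVector p (ZMod p)} :
    constMap p L z ∈ vIdeal p n L ↔ z ∈ vIdeal p n (ZMod p) :=
  ⟨mem_vIdeal_of_map_mem (RingHom.injective _), map_mem_vIdeal _⟩

theorem galMap_constMap (g : Gal(L/K)) (z : WittVector p (ZMod p)) :
    galMap p g (constMap p L z) = constMap p L z := by
  ext i
  rw [coeff_galMap, coeff_constMap]
  exact DFunLike.congr_fun
    (Subsingleton.elim ((g : L →+* L).comp (ZMod.castHom (dvd_refl p) L)) _) _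

/-- The roots of t^p = t in the field L are exactly the elements of the prime field. -/
theorem exists_sub_constMap_mem_vIdeal {x : WittVector p L}
    (hx : wittWp p L x ∈ vIdeal p n L) : ∃ z, x - constMap p L z ∈ vIdeal p n L := by
  rw [wittWp_mem_vIdeal_iff] at hx
  have h (i : ℕ) : ∃ z : ZMod p, (i : ℕ∞) < n → x.coeff i = ZMod.castHom (dvd_refl p) L z := by
    by_cases hi : (i : ℕ∞) < n
    · have h1 := (Subfield.mem_bot_iff_pow_eq_self L p).2 (hx i hi)
      rw [← ZMod.fieldRange_castHom_eq_bot p] at h1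
      obtain ⟨z, hz⟩ := h1
      exact ⟨z, fun _ => hz.symm⟩
    · exact ⟨0, fun h => (hi h).elim⟩
  choose z hz using h
  refine ⟨WittVector.mk p z, sub_mem_vIdeal.2 fun i hi => ?_⟩
  rw [coeff_constMap, WittVector.coeff_mk]
  exact hz i hi

theorem exists_eq_constMap {x : WittVector p L} (hx : wittWp p L x = 0) :
    ∃ z, x = constMap p L z := by
  obtain ⟨z, hz⟩ := exists_sub_constMap_mem_vIdeal (mem_vIdeal_top.2 hx)
  exact ⟨z, sub_eq_zero.1 (mem_vIdeal_top.1 hz)⟩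

theorem galMap_wittWp (g : Gal(L/K)) (x : WittVector p L) :
    galMap p g (wittWp p L x) = wittWp p L (galMap p g x) :=
  map_wittWp _ _

theorem exists_galMap_sub_eq_constMap (g : Gal(L/K)) {a : WittVector p L} {c : WittVector p K}
    (h : wittWp p L a = WittVector.map (algebraMap K L) c) :
    ∃ z, galMap p g a - a = constMap p L z := by
  apply exists_eq_constMap
  rw [map_sub, ← galMap_wittWp, h, galMap_map_algebraMap, sub_self]

theorem exists_wittWp_eq_of_isSepClosed [IsSepClosed L] (c : WittVector p L) :
    ∃ a, wittWp p L a = c := by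
  suffices H : ∃ a : WittVector p L, ∀ k : ℕ, (k : ℕ∞) ≤ ⊤ → wittWp p L a - c ∈ vIdeal p k L by
    obtain ⟨a, ha⟩ := H
    exact ⟨a, sub_eq_zero.1 (mem_vIdeal_top.1 (mem_vIdeal_of_forall_natCast ha))⟩
  refine exists_of_approximation (n := ⊤)
    (fun k (a : WittVector p L) => wittWp p L a - c ∈ vIdeal p k L) ⟨0, mem_vIdeal_zero _⟩ ?_ ?_
  · intro k x y hxy hx
    have : wittWp p L y - c = wittWp p L (y - x) + (wittWp p L x - c) := by
      rw [map_sub]; ring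
    rw [this]
    exact add_mem (wittWp_mem_vIdeal hxy) hx
  · intro k x _ hx
    -- Adding y in V^k W(L) with k-th coefficient b changes the k-th coefficient of ℘x by b^p - b;
    -- the polynomial to be solved has derivative -1, so it is separable.
    obtain ⟨b, hb⟩ := IsSepClosed.exists_root_C_mul_X_pow_add_C_mul_X_add_C' p p (1 : L) (-1)
      ((wittWp p L x - c).coeff k) dvd_rfl hp.out.two_le (by simp)
    obtain ⟨y, hy, hyk⟩ := exists_mem_vIdeal_coeff_eq p k b
    refine ⟨x + y, by simpa using hy, ?_⟩
    have : wittWp p L (x + y) - c = wittWp p L y + (wittWp p L x - c) := by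
      rw [map_add]; ring
    rw [this, mem_vIdeal_succ]
    refine ⟨add_mem (wittWp_mem_vIdeal hy) hx, ?_⟩
    rw [coeff_add_of_mem_vIdeal (wittWp_mem_vIdeal hy) hx, coeff_wittWp_of_mem_vIdeal hy, hyk]
    linear_combination hb

/-- Both g and h translate a by constants, which are Galois-invariant, and translations commute. -/
theorem galMap_comm_of_wittWp_eq (g h : Gal(L/K)) {a : WittVector p L} {c : WittVector p K}
    (hac : wittWp p L a = WittVector.map (algebraMap K L) c) :
    galMap p g (galMap p h a) = galMap p h (galMap p g a) := by
  obtain ⟨z, hz⟩ := exists_galMap_sub_eq_constMap g hac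
  obtain ⟨w, hw⟩ := exists_galMap_sub_eq_constMap h hac
  rw [sub_eq_iff_eq_add] at hz hw
  rw [hw, hz, map_add, map_add, galMap_constMap, galMap_constMap, hz, hw]
  ring

/-- The field generated by the coefficients of a solution of `℘ a = c`, with `c` in `W(K)`, is
abelian over `K`. -/
theorem isAbelianGalois_adjoin_coeff [IsGalois K L] {a : WittVector p L} {c : WittVector p K}
    (hac : wittWp p L a = WittVector.map (algebraMap K L) c) :
    IsAbelianGalois K (IntermediateField.adjoin K (Set.range a.coeff)) := by
  set E := IntermediateField.adjoin K (Set.range a.coeff) with hE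
  have : CharP E p := RingHom.charP E.val.toRingHom E.val.injective p
  have hmem (i : ℕ) : a.coeff i ∈ E := IntermediateField.subset_adjoin _ _ ⟨i, rfl⟩
  let a' : WittVector p E := WittVector.mk p fun i => ⟨a.coeff i, hmem i⟩
  have ha' : WittVector.map E.val.toRingHom a' = a := by
    ext i
    rw [WittVector.map_coeff]
    rfl
  have hac' : wittWp p E a' = WittVector.map (algebraMap K E) c := by
    apply WittVector.map_injective E.val.toRingHom E.val.injective
    rw [map_wittWp, ha', hac]
    ext i
    simp only [WittVector.map_coeff]
    rfl
  -- A conjugate of a is a plus a constant, and this sum can be formed inside W(E).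
  have hn : Normal K E := by
    rw [IntermediateField.normal_iff_forall_map_le']
    intro σ
    rw [hE, IntermediateField.adjoin_map, ← hE, IntermediateField.adjoin_le_iff]
    rintro _ ⟨_, ⟨i, rfl⟩, rfl⟩
    obtain ⟨z, hz⟩ := exists_galMap_sub_eq_constMap σ hac
    rw [sub_eq_iff_eq_add] at hz
    have h1 : σ (a.coeff i) = ((constMap p E z + a').coeff i : E) := by
      have h2 : WittVector.map E.val.toRingHom (constMap p E z + a') = galMap p σ a := by
        rw [map_add, ha', hz]
        congr 1
        ext j
        rw [WittVector.map_coeff, coeff_constMap, coeff_constMap]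
        exact DFunLike.congr_fun (Subsingleton.elim
          (E.val.toRingHom.comp (ZMod.castHom (dvd_refl p) E)) _) _
      rw [← coeff_galMap, ← h2, WittVector.map_coeff]
      rfl
    change σ (a.coeff i) ∈ E
    rw [h1]
    exact Subtype.coe_prop _
  have hs : Algebra.IsSeparable K E := inferInstance
  have hg : IsGalois K E := ⟨⟩
  refine { is_comm := ⟨fun g h => ?_⟩ }
  have key : ((g * h : Gal(E/K)) : E →ₐ[K] E) = ((h * g : Gal(E/K)) : E →ₐ[K] E) := by
    refine IntermediateField.algHom_ext_of_eq_adjoin K hE ?_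
    rintro _ ⟨i, rfl⟩
    have := congrArg (fun t => WittVector.coeff t i) (galMap_comm_of_wittWp_eq g h hac')
    simp only [coeff_galMap] at this
    exact this
  exact AlgEquiv.ext fun x => DFunLike.congr_fun key x

end Galois

theorem exists_wittWp_eq_maxAbelian (p : ℕ) [Fact p.Prime] {K Ω : Type*} [Field K] [CharP K p]
    [Field Ω] [Algebra K Ω] [IsSepClosure K Ω] (c : WittVector p K) :
    ∃ a, wittWp p (maxAbelian K Ω) a = WittVector.map (algebraMap K (maxAbelian K Ω)) c := by
  have : IsSepClosed Ω := IsSepClosure.sep_closed K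
  have : CharP Ω p := charP_of_injective_algebraMap (algebraMap K Ω).injective p
  obtain ⟨a, ha⟩ := exists_wittWp_eq_of_isSepClosed (WittVector.map (algebraMap K Ω) c)
  have hle := le_maxAbelian K Ω _ (isAbelianGalois_adjoin_coeff ha)
  refine ⟨WittVector.mk p fun i =>
    ⟨a.coeff i, hle (IntermediateField.subset_adjoin _ _ ⟨i, rfl⟩)⟩, ?_⟩
  apply WittVector.map_injective (maxAbelian K Ω).val.toRingHom (maxAbelian K Ω).val.injective
  rw [map_wittWp]
  have h1 : WittVector.map (maxAbelian K Ω).val.toRingHom (WittVector.mk p fun i =>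
    ⟨a.coeff i, hle (IntermediateField.subset_adjoin _ _ ⟨i, rfl⟩)⟩) = a := by
    ext i
    rw [WittVector.map_coeff]
    rfl
  rw [h1, ha]
  ext i
  simp only [WittVector.map_coeff]
  rfl

/-! ### Galois descent and Hilbert 90 for Witt vectors. -/

section Descent

variable {p : ℕ} [hp : Fact p.Prime] {n : ℕ∞} {K L : Type*} [Field K] [Field L] [Algebra K L]
  [IsGalois K L]

theorem exists_sub_map_mem_vIdeal {a : WittVector p L}
    (h : ∀ g : Gal(L/K), galMap p g a - a ∈ vIdeal p n L) :
    ∃ b, a - WittVector.map (algebraMap K L) b ∈ vIdeal p n L := by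
  have h (i : ℕ) : ∃ b : K, (i : ℕ∞) < n → a.coeff i = algebraMap K L b := by
    by_cases hi : (i : ℕ∞) < n
    · obtain ⟨b, hb⟩ := (InfiniteGalois.mem_range_algebraMap_iff_fixed (a.coeff i)).2 fun g => by
        simpa using sub_mem_vIdeal.1 (h g) i hi
      exact ⟨b, fun _ => hb.symm⟩
    · exact ⟨0, fun h => (hi h).elim⟩
  choose b hb using h
  refine ⟨WittVector.mk p b, sub_mem_vIdeal.2 fun i hi => ?_⟩
  rw [WittVector.map_coeff, WittVector.coeff_mk]
  exact hb i hi

open Topology in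
theorem eventually_galMap_sub_mem_vIdeal (a : WittVector p L) (k : ℕ) :
    ∀ᶠ g : Gal(L/K) in 𝓝 1, galMap p g a - a ∈ vIdeal p k L := by
  have h (i : ℕ) : ∀ᶠ g : Gal(L/K) in 𝓝 1, g (a.coeff i) = a.coeff i :=
      (stabilizer_isOpen_of_isIntegral (K := K) (a.coeff i)).mem_nhds
      (one_mem (MulAction.stabilizer Gal(L/K) (a.coeff i)))
  have h2 := (Filter.eventually_all_finset (Finset.range k)).2 fun i _ => h i
  filter_upwards [h2] with g hg
  rw [sub_mem_vIdeal]
  intro i hi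
  rw [coeff_galMap]
  exact hg i (by simpa using hi)

open Topology in
/-- Additive Hilbert 90 for continuous cocycles. -/
theorem exists_eq_sub_of_cocycle (z : Gal(L/K) → L)
    (hz : ∀ g h, z (g * h) = z g + g (z h)) (hz1 : ∀ᶠ g in 𝓝 1, z g = 0) :
    ∃ b : L, ∀ g, z g = g b - b := by
  -- The cocycle vanishes on Gal(L/E) for some finite Galois E, hence depends only on restrictions
  -- to E (`hinv`).
  obtain ⟨E, hE⟩ := (InfiniteGalois.krullTopology_mem_nhds_one_iff_of_isGalois _).1 hz1
  obtain ⟨w, hw⟩ := Algebra.trace_surjective K E 1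
  have hinv (g h : Gal(L/K)) (hgh : AlgEquiv.restrictNormalHom E g =
      AlgEquiv.restrictNormalHom E h) : z g = z h := by
    have h1 : h⁻¹ * g ∈ E.fixingSubgroup := by
      rw [← IntermediateField.restrictNormalHom_ker, MonoidHom.mem_ker, map_mul, map_inv, hgh,
        inv_mul_cancel]
    have h2 : z (h⁻¹ * g) = 0 := hE h1
    have := hz h (h⁻¹ * g)
    rwa [mul_inv_cancel_left, h2, map_zero, add_zero] at this
  have hsurj := AlgEquiv.restrictNormalHom_surjective (F := K) (K₁ := E) L
  obtain ⟨s, hs⟩ := hsurj.hasRightInverse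
  have hact (g : Gal(L/K)) (τ : Gal(E/K)) :
      g (algebraMap E L (τ w)) = algebraMap E L ((AlgEquiv.restrictNormalHom E g * τ) w) := by
    rw [AlgEquiv.mul_apply]
    exact (AlgEquiv.restrictNormal_commutes g E (τ w)).symm
  have htr : ∑ τ : Gal(E/K), algebraMap E L (τ w) = 1 := by
    rw [← map_sum, ← trace_eq_sum_automorphisms, hw, map_one, map_one]
  -- With w of trace 1, applying g to S = ∑ z(τ) τ(w) and reindexing by gτ gives gS = S - z(g).
  refine ⟨-∑ τ : Gal(E/K), z (s τ) * algebraMap E L (τ w), fun g => ?_⟩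
  have h1 : g (∑ τ : Gal(E/K), z (s τ) * algebraMap E L (τ w)) =
      ∑ τ : Gal(E/K), (z (s τ) - z g) * algebraMap E L (τ w) := by
    rw [map_sum, ← Equiv.sum_comp (Equiv.mulLeft (AlgEquiv.restrictNormalHom E g))
      (fun τ => (z (s τ) - z g) * algebraMap E L (τ w))]
    refine Finset.sum_congr rfl fun τ _ => ?_
    rw [map_mul, hact, Equiv.coe_mulLeft]
    congr 1
    have h2 : z (s (AlgEquiv.restrictNormalHom E g * τ)) = z (g * s τ) := by
      apply hinv
      rw [hs, map_mul, hs]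
    rw [h2, hz]
    ring
  rw [map_neg, h1]
  simp only [sub_mul, Finset.sum_sub_distrib]
  rw [← Finset.mul_sum, htr]
  ring

variable [CharP L p]

open Topology in
-- Here χ lifts a character with values in W_n(𝔽_p), so it is additive only modulo V^n. If x solves
-- the problem modulo V^k, the k-th coefficient of the error is a continuous cocycle in L, and
-- Hilbert 90 supplies the correction.
theorem exists_galMap_sub_eq_of_character (χ : Gal(L/K) → WittVector p (ZMod p))
    (hχ : ∀ g h, χ (g * h) - (χ g + χ h) ∈ vIdeal p n (ZMod p))
    (hχ1 : ∀ k : ℕ, (k : ℕ∞) ≤ n → ∀ᶠ g in 𝓝 1, χ g ∈ vIdeal p k (ZMod p)) :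
    ∃ a, ∀ g, galMap p g a - a - constMap p L (χ g) ∈ vIdeal p n L := by
  suffices H : ∃ a : WittVector p L, ∀ k : ℕ, (k : ℕ∞) ≤ n →
      ∀ g : Gal(L/K), galMap p g a - a - constMap p L (χ g) ∈ vIdeal p k L by
    obtain ⟨a, ha⟩ := H
    exact ⟨a, fun g => mem_vIdeal_of_forall_natCast fun k hk => ha k hk g⟩
  refine exists_of_approximation (n := n)
    (fun k (a : WittVector p L) =>
      ∀ g : Gal(L/K), galMap p g a - a - constMap p L (χ g) ∈ vIdeal p k L)
    ⟨0, fun g => mem_vIdeal_zero _⟩ ?_ ?_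
  · intro k x y hxy hx g
    have : galMap p g y - y - constMap p L (χ g) = galMap p g (y - x) - (y - x) +
        (galMap p g x - x - constMap p L (χ g)) := by
      rw [map_sub]; ring
    rw [this]
    exact add_mem (sub_mem (galMap_mem_vIdeal g hxy) hxy) (hx g)
  · intro k x hk hx
    let e (g : Gal(L/K)) := galMap p g x - x - constMap p L (χ g)
    suffices H : ∃ b : L, ∀ g, (e g).coeff k = g b - b by
      obtain ⟨b, hb⟩ := H
      obtain ⟨y, hy, hyk⟩ := exists_mem_vIdeal_coeff_eq p k b
      refine ⟨x - y, by simpa using hy, fun g => ?_⟩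
      have : galMap p g (x - y) - (x - y) - constMap p L (χ g) = e g - (galMap p g y - y) := by
        simp only [e]
        rw [map_sub]; ring
      rw [this, mem_vIdeal_succ]
      have hgy := galMap_mem_vIdeal g hy
      refine ⟨sub_mem (hx g) (sub_mem hgy hy), ?_⟩
      rw [coeff_sub_of_mem_vIdeal (hx g) (sub_mem hgy hy), coeff_sub_of_mem_vIdeal hgy hy,
        coeff_galMap, hyk, hb g, sub_self]
    refine exists_eq_sub_of_cocycle _ ?_ ?_
    · intro g h
      have h1 : e (g * h) = e g + galMap p g (e h) -
          constMap p L (χ (g * h) - (χ g + χ h)) := by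
        simp only [e]
        rw [galMap_mul, map_sub, map_sub, map_sub, galMap_constMap, map_add]
        ring
      -- Since k + 1 ≤ n, the non-additivity of χ does not reach the k-th coefficient.
      have h2 : constMap p L (χ (g * h) - (χ g + χ h)) ∈ vIdeal p ((k + 1 : ℕ) : ℕ∞) L :=
        constMap_mem_vIdeal_iff.2 (vIdeal_anti hk (hχ g h))
      rw [mem_vIdeal_succ] at h2
      have h3 := galMap_mem_vIdeal g (hx h)
      change (e (g * h)).coeff k = _
      rw [h1, coeff_sub_of_mem_vIdeal (add_mem (hx g) h3) h2.1, h2.2, sub_zero,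
        coeff_add_of_mem_vIdeal (hx g) h3, coeff_galMap]
    · filter_upwards [eventually_galMap_sub_mem_vIdeal x (k + 1), hχ1 (k + 1) hk] with g h1 h2
      exact (mem_vIdeal_succ.1 (sub_mem h1 (constMap_mem_vIdeal_iff.2 h2))).2

end Descent

/-! ### The pairing lifted to W(K), with values in W(𝔽_p). -/

section Pairing

/-- Modulo ℘, elements of V^k are multiples of p^k, and p^k W(𝔽_p) lies in V^k W(𝔽_p). -/
theorem apply_mem_vIdeal_of_wittWp_eq_zero {p : ℕ} [Fact p.Prime] {n : ℕ∞} {R : Type*}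
    [CommRing R] [CharP R p] {z : WittVector p R →+ WittVector p (ZMod p)}
    (hz : ∀ b, z (wittWp p R b) = 0) {c : WittVector p R} (hc : c ∈ vIdeal p n R) :
    z c ∈ vIdeal p n (ZMod p) := by
  refine mem_vIdeal_of_forall_natCast fun k hk => ?_
  obtain ⟨y, b, rfl⟩ := exists_sub_pow_mul_mem_range (vIdeal_anti hk hc)
  rw [map_add, hz, add_zero]
  have : (p : WittVector p R) ^ k * y = (p ^ k) • y := by simp
  rw [this, map_nsmul]
  simpa using pow_mul_mem_vIdeal k (z y)

variable {p : ℕ} [hp : Fact p.Prime] {n : ℕ∞} {K L : Type*} [Field K] [Field L] [CharP L p]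
  [Algebra K L]

/-- `D g c = g a - a` for all `g` in `Gal(L/K)`, `c` in `W(K)` and `a` in `W(L)` with `℘ a = c`. -/
def IsWittCocycle (D : Gal(L/K) → WittVector p K →+ WittVector p (ZMod p)) : Prop :=
  ∀ g a c, wittWp p L a = WittVector.map (algebraMap K L) c →
    constMap p L (D g c) = galMap p g a - a

/-- Two solutions a for the same c differ by a constant, which cancels in ga - a. Additivity in c
follows by using the sum of two solutions. -/
theorem exists_isWittCocycle
    (hL : ∀ c : WittVector p K, ∃ a, wittWp p L a = WittVector.map (algebraMap K L) c) :
    ∃ D : Gal(L/K) → WittVector p K →+ WittVector p (ZMod p), IsWittCocycle D := by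
  choose s hs using hL
  have h (g : Gal(L/K)) (c : WittVector p K) := exists_galMap_sub_eq_constMap g (hs c)
  choose D hD using h
  have key (g a c) (h : wittWp p L a = WittVector.map (algebraMap K L) c) :
      constMap p L (D g c) = galMap p g a - a := by
    obtain ⟨z, hz⟩ := exists_eq_constMap (x := a - s c) (by rw [map_sub, h, hs, sub_self])
    rw [sub_eq_iff_eq_add] at hz
    rw [← hD, hz, map_add, galMap_constMap]
    ring
  refine ⟨fun g => AddMonoidHom.mk' (D g) fun c d => constMap_injective (L := L) ?_, key⟩
  rw [key g (s c + s d) (c + d) (by rw [map_add, map_add, hs, hs]), map_add, map_add, ← hD, ← hD]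
  ring

namespace IsWittCocycle

variable {D : Gal(L/K) → WittVector p K →+ WittVector p (ZMod p)}

theorem apply_wittWp [CharP K p] (hD : IsWittCocycle D) (g : Gal(L/K)) (b : WittVector p K) :
    D g (wittWp p K b) = 0 := by
  apply constMap_injective (L := L)
  rw [hD g (WittVector.map (algebraMap K L) b) _ (map_wittWp _ _).symm, galMap_map_algebraMap,
    sub_self, map_zero]

theorem mul_apply 
    (hL : ∀ c : WittVector p K, ∃ a, wittWp p L a = WittVector.map (algebraMap K L) c)
    (hD : IsWittCocycle D) (g h : Gal(L/K)) (c : WittVector p K) :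
    D (g * h) c = D g c + D h c := by
  obtain ⟨a, ha⟩ := hL c
  apply constMap_injective (L := L)
  rw [hD _ a c ha, map_add, hD _ a c ha]
  have h1 := hD h a c ha
  have h2 : galMap p h a = a + constMap p L (D h c) := by rw [h1]; ring
  rw [galMap_mul, h2, map_add, galMap_constMap]
  ring

/-- This transfers the formula to W_n, where ℘a = c holds only modulo V^n: such an a differs from an
exact solution by a constant modulo V^n. -/
theorem sub_mem_vIdeal_of_mem 
    (hL : ∀ c : WittVector p K, ∃ a, wittWp p L a = WittVector.map (algebraMap K L) c)
    (hD : IsWittCocycle D) (g : Gal(L/K)) {a : WittVector p L}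
    {c : WittVector p K}
    (hac : wittWp p L a - WittVector.map (algebraMap K L) c ∈ vIdeal p n L) :
    constMap p L (D g c) - (galMap p g a - a) ∈ vIdeal p n L := by
  obtain ⟨s, hs⟩ := hL c
  rw [← hs, ← map_sub] at hac
  obtain ⟨z, hz⟩ := exists_sub_constMap_mem_vIdeal hac
  rw [hD g s c hs]
  have : galMap p g s - s - (galMap p g a - a) =
      (a - s - constMap p L z) - galMap p g (a - s - constMap p L z) := by
    rw [map_sub, map_sub, galMap_constMap]
    ring
  rw [this]
  exact sub_mem hz (galMap_mem_vIdeal g hz)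

open Topology in
theorem eventually_apply_mem [IsGalois K L] 
    (hL : ∀ c : WittVector p K, ∃ a, wittWp p L a = WittVector.map (algebraMap K L) c)
    (hD : IsWittCocycle D) (c : WittVector p K) (k : ℕ) :
    ∀ᶠ g in 𝓝 1, D g c ∈ vIdeal p k (ZMod p) := by
  obtain ⟨a, ha⟩ := hL c
  filter_upwards [eventually_galMap_sub_mem_vIdeal a k] with g hg
  rw [← hD g a c ha] at hg
  exact constMap_mem_vIdeal_iff.1 hg

theorem exists_sub_wittWp_mem [IsGalois K L] [CharP K p] 
    (hL : ∀ c : WittVector p K, ∃ a, wittWp p L a = WittVector.map (algebraMap K L) c)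
    (hD : IsWittCocycle D) {c : WittVector p K}
    (hc : ∀ g, D g c ∈ vIdeal p n (ZMod p)) : ∃ b, c - wittWp p K b ∈ vIdeal p n K := by
  obtain ⟨a, ha⟩ := hL c
  obtain ⟨b, hb⟩ := exists_sub_map_mem_vIdeal (K := K) (a := a) (n := n) fun g => by
    rw [← hD g a c ha]
    exact constMap_mem_vIdeal_iff.2 (hc g)
  refine ⟨b, mem_vIdeal_of_map_mem (algebraMap K L).injective ?_⟩
  rw [map_sub, map_wittWp, ← ha, ← map_sub]
  exact wittWp_mem_vIdeal hb

open Topology in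
theorem exists_eq_character [IsGalois K L] 
    (hL : ∀ c : WittVector p K, ∃ a, wittWp p L a = WittVector.map (algebraMap K L) c)
    (hD : IsWittCocycle D)
    (χ : Gal(L/K) → WittVector p (ZMod p))
    (hχ : ∀ g h, χ (g * h) - (χ g + χ h) ∈ vIdeal p n (ZMod p))
    (hχ1 : ∀ k : ℕ, (k : ℕ∞) ≤ n → ∀ᶠ g in 𝓝 1, χ g ∈ vIdeal p k (ZMod p)) :
    ∃ c, ∀ g, D g c - χ g ∈ vIdeal p n (ZMod p) := by
  obtain ⟨a, ha⟩ := exists_galMap_sub_eq_of_character (L := L) χ hχ hχ1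
  -- As ga - a is constant modulo V^n and ℘ kills constants, ℘a is invariant modulo V^n and descends
  -- to K.
  obtain ⟨c, hc⟩ := exists_sub_map_mem_vIdeal (K := K) (a := wittWp p L a) (n := n) fun g => by
    have : galMap p g (wittWp p L a) - wittWp p L a =
        wittWp p L (galMap p g a - a - constMap p L (χ g)) := by
      rw [map_sub, map_sub, galMap_wittWp, constMap, ← map_wittWp, wittWp_zmod, map_zero, sub_zero]
    rw [this]
    exact wittWp_mem_vIdeal (ha g)
  refine ⟨c, fun g => ?_⟩
  rw [← constMap_mem_vIdeal_iff (L := L), map_sub]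
  have := add_mem (sub_mem_vIdeal_of_mem hL hD g hc) (ha g)
  rwa [sub_add_sub_cancel] at this

end IsWittCocycle

end Pairing

/-! ### Duality for finite, torsion and compact groups. -/

section Duality

/-- Realising ℤ/N as the N-th roots of unity makes duality of finite abelian groups over ℂ available
for the coefficient group W_n(𝔽_p). -/
theorem exists_zmod_embedding (N : ℕ) [NeZero N] :
    ∃ j : ZMod N →+ Additive ℂˣ, Function.Injective j ∧
      ∀ u : ℂˣ, u ^ N = 1 → ∃ x, j x = Additive.ofMul u := by
  have hζ := (Complex.isPrimitiveRoot_exp N (NeZero.ne N)).isUnit_unit (NeZero.ne N)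
  set ζ := ((Complex.isPrimitiveRoot_exp N (NeZero.ne N)).isUnit (NeZero.ne N)).unit
  refine ⟨(MonoidHom.toAdditive (Subgroup.zpowers ζ).subtype).comp
    hζ.zmodEquivZPowers.toAddMonoidHom, ?_, fun u hu => ?_⟩
  · exact Subtype.val_injective.comp hζ.zmodEquivZPowers.injective
  · have : u ∈ Subgroup.zpowers ζ := by
      rw [hζ.zpowers_eq]
      exact hu
    refine ⟨hζ.zmodEquivZPowers.symm (Additive.ofMul ⟨u, this⟩), ?_⟩
    change Additive.ofMul ((Additive.toMul (hζ.zmodEquivZPowers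
      (hζ.zmodEquivZPowers.symm (Additive.ofMul ⟨u, this⟩))) : Subgroup.zpowers ζ) : ℂˣ) = _
    rw [AddEquiv.apply_symm_apply]
    rfl

theorem card_addMonoidHom_units_complex (X : Type*) [AddCommGroup X] [Finite X] :
    Nat.card (X →+ Additive ℂˣ) = Nat.card X := by
  have := CommGroup.card_monoidHom_of_hasEnoughRootsOfUnity (Multiplicative X) ℂ
  rw [Nat.card_congr (AddMonoidHom.toMultiplicativeLeft (α := X) (β := ℂˣ)), this]
  rfl

theorem finite_addMonoidHom_units_complex (X : Type*) [AddCommGroup X] [Finite X] :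
    Finite (X →+ Additive ℂˣ) :=
  Nat.finite_of_card_ne_zero (by rw [card_addMonoidHom_units_complex]; exact Nat.card_pos.ne')

/-- A pairing of a finite abelian group with an arbitrary group, which is non-degenerate on the
side of the finite group, induces all its characters. -/
theorem exists_eq_of_nondegenerate_of_finite {G M A : Type*} [Group G] [AddCommGroup M] [Finite M]
    [AddCommGroup A] (j : A →+ Additive ℂˣ) (hj : Function.Injective j) (β : G → M →+ A)
    (hβ : ∀ x y, β (x * y) = β x + β y) (hnd : ∀ m, (∀ g, β g m = 0) → m = 0) (f : M →+ A) :
    ∃ g, β g = f := by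
  let β' : Additive G →+ (M →+ A) := AddMonoidHom.mk' (fun g => β g.toMul) fun x y => hβ _ _
  have hinj : Function.Injective (fun φ : M →+ A => j.comp φ) := fun φ ψ h =>
    AddMonoidHom.ext fun m => hj (DFunLike.congr_fun h m)
  have := finite_addMonoidHom_units_complex M
  have : Finite (M →+ A) := Finite.of_injective _ hinj
  have h1 : Nat.card (M →+ A) ≤ Nat.card M := by
    rw [← card_addMonoidHom_units_complex M]
    exact Nat.card_le_card_of_injective _ hinj
  let ev : M → (β'.range →+ Additive ℂˣ) := fun m =>
    j.comp ((AddMonoidHom.eval m).comp β'.range.subtype)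
  have hev : Function.Injective ev := by
    intro m m' h
    rw [← sub_eq_zero]
    refine hnd _ fun g => ?_
    have h2 := DFunLike.congr_fun h ⟨β' (Additive.ofMul g), _, rfl⟩
    have h3 : β g m = β g m' := hj h2
    rw [map_sub, h3, sub_self]
  have := finite_addMonoidHom_units_complex β'.range
  have h2 : Nat.card M ≤ Nat.card β'.range := by
    rw [← card_addMonoidHom_units_complex β'.range]
    exact Nat.card_le_card_of_injective _ hev
  -- The bounds |Hom(M, A)| ≤ |M| ≤ |range| leave no room for a proper subgroup.
  have h3 : β'.range = ⊤ := AddSubgroup.eq_top_of_le_card _ (h1.trans h2)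
  obtain ⟨g, hg⟩ : f ∈ β'.range := h3 ▸ AddSubgroup.mem_top f
  exact ⟨g.toMul, hg⟩

/-- The conditions on g are closed, and finitely many of them only involve a finitely generated
torsion group, which is finite. Compactness does the rest. -/
theorem exists_eq_of_nondegenerate {G M A : Type*} [Group G] [TopologicalSpace G] [CompactSpace G]
    [AddCommGroup M] [AddCommGroup A] (j : A →+ Additive ℂˣ) (hj : Function.Injective j)
    (hM : IsAddTorsion M) (β : G → M →+ A) (hβ : ∀ x y, β (x * y) = β x + β y)
    (hcl : ∀ m a, IsClosed {g | β g m = a}) (hnd : ∀ m, (∀ g, β g m = 0) → m = 0) (f : M →+ A) :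
    ∃ g, β g = f := by
  have h := isCompact_univ.inter_iInter_nonempty (fun m : M => {g | β g m = f m})
    (fun m => hcl m _) fun u => by
      let S := AddSubgroup.closure (u : Set M)
      have hfg : AddGroup.FG S := (AddGroup.fg_iff_addSubgroup_fg S).2 ⟨u, rfl⟩
      have hS : IsAddTorsion S := hM.addSubgroup S
      have : Finite S := AddCommGroup.finite_of_fg_isAddTorsion S hS
      obtain ⟨g, hg⟩ := exists_eq_of_nondegenerate_of_finite j hj
        (fun g => (β g).comp S.subtype) (fun x y => by rw [hβ]; rfl)
        (fun m hm => Subtype.ext (hnd m hm)) (f.comp S.subtype)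
      refine ⟨g, trivial, Set.mem_iInter₂.2 fun m hm => ?_⟩
      exact DFunLike.congr_fun hg ⟨m, AddSubgroup.subset_closure hm⟩
  obtain ⟨g, -, hg⟩ := h
  exact ⟨g, AddMonoidHom.ext fun m => Set.mem_iInter.1 hg m⟩

theorem isClosed_powSubgroup (p : ℕ) (G : Type*) [CommGroup G] [TopologicalSpace G]
    [IsTopologicalGroup G] [CompactSpace G] [T2Space G] (n : ℕ) :
    IsClosed (powSubgroup p G n : Set G) := by
  have : (powSubgroup p G n : Set G) = Set.range fun x : G => x ^ p ^ n := by
    ext; simp [powSubgroup]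
  rw [this]
  exact (isCompact_range (continuous_pow _)).isClosed

open Topology in
-- As p^n G is closed, some open subgroup V has gV disjoint from it. Then g survives in the finite
-- group G/(p^n G · V), whose characters separate points.
theorem exists_character_ne_one (p : ℕ) {G : Type*} [CommGroup G] [TopologicalSpace G]
    [NonarchimedeanGroup G] [CompactSpace G] [T2Space G] (n : ℕ) {g : G}
    (hg : g ∉ powSubgroup p G n) :
    ∃ χ : G →* ℂˣ, χ g ≠ 1 ∧ (∀ x, χ x ^ p ^ n = 1) ∧ ∀ᶠ x in 𝓝 1, χ x = 1 := by
  have hU : (fun x => g * x) ⁻¹' (powSubgroup p G n : Set G)ᶜ ∈ 𝓝 (1 : G) :=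
    ((isClosed_powSubgroup p G n).isOpen_compl.preimage (continuous_const_mul g)).mem_nhds
      (by simpa using hg)
  obtain ⟨V, hV⟩ := NonarchimedeanGroup.is_nonarchimedean _ hU
  let Q : Subgroup G := powSubgroup p G n ⊔ (V : Subgroup G)
  have hVQ : (V : Subgroup G) ≤ Q := le_sup_right
  have hQ : IsOpen (Q : Set G) := Subgroup.isOpen_mono hVQ V.isOpen
  have : Finite (G ⧸ Q) := Subgroup.quotient_finite_of_isOpen Q hQ
  have hgQ : (g : G ⧸ Q) ≠ 1 := by
    rw [Ne, QuotientGroup.eq_one_iff]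
    intro h
    obtain ⟨x, hx, v, hv, hxv⟩ := Subgroup.mem_sup.1 h
    have h1 := hV (inv_mem hv)
    apply h1
    change g * v⁻¹ ∈ powSubgroup p G n
    rwa [← hxv, mul_inv_cancel_right]
  obtain ⟨χ, hχ⟩ := CommGroup.exists_apply_ne_one_of_hasEnoughRootsOfUnity (G ⧸ Q) ℂ hgQ
  refine ⟨χ.comp (QuotientGroup.mk' Q), hχ, fun x => ?_, ?_⟩
  · rw [← map_pow, MonoidHom.comp_apply]
    have : QuotientGroup.mk' Q (x ^ p ^ n) = 1 := by
      rw [QuotientGroup.mk'_apply, QuotientGroup.eq_one_iff]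
      exact Subgroup.mem_sup_left ⟨x, rfl⟩
    rw [this, map_one]
  · filter_upwards [hQ.mem_nhds (one_mem Q)] with x hx
    have : QuotientGroup.mk' Q x = 1 := by
      rw [QuotientGroup.mk'_apply, QuotientGroup.eq_one_iff]
      exact hx
    rw [MonoidHom.comp_apply, this, map_one]

end Duality

/-! ### A topological criterion for perfectness. -/

open Topology in
/-- A criterion for a pairing with a compact group, of filtered groups `M` and `A`, to be
perfect. -/
theorem isPerfectTopPairing_of_basis {H M A : Type*} [Group H] [TopologicalSpace H]
    [CompactSpace H] [AddCommGroup M] [TopologicalSpace M] [IsTopologicalAddGroup M]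
    [AddCommGroup A] [TopologicalSpace A] [IsTopologicalAddGroup A] [T2Space A]
    {UM : ℕ → AddSubgroup M} (hUM : (𝓝 (0 : M)).HasBasis (fun _ => True) (fun k => (UM k : Set M)))
    {UA : ℕ → AddSubgroup A} (hUA : (𝓝 (0 : A)).HasBasis (fun _ => True) (fun k => (UA k : Set A)))
    (B : H → M →+ A) (hmul : ∀ x y m, B (x * y) m = B x m + B y m)
    (hcont : ∀ m, Continuous fun h => B h m)
    (hU : ∀ (f : M →+ A) k m, m ∈ UM k → f m ∈ UA k)
    (hinj : ∀ h, (∀ m, B h m = 0) → h = 1) (hsurj : ∀ f : M →+ A, ∃ h, B h = f)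
    (hker : ∀ k m, (∀ h, B h m ∈ UA k) → m ∈ UM k) (hker' : ∀ m, (∀ h, B h m = 0) → m = 0)
    (hsurj' : ∀ χ : H → A, Continuous χ → (∀ x y, χ (x * y) = χ x + χ y) →
      ∃ m, ∀ h, B h m = χ h) :
    IsPerfectTopPairing fun h m => B h m := by
  have hfc (f : M →+ A) : Continuous f := by
    refine continuous_of_continuousAt_zero f ?_
    rw [ContinuousAt, map_zero]
    exact (hUM.tendsto_iff hUA).2 fun k _ => ⟨k, trivial, fun m hm => hU f k m hm⟩
  -- Split B(h, m) = B(h, m - m₀) + B(h, m₀): the first term is small uniformly in h by `hU`.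
  have hjoint : Continuous fun q : H × M => B q.1 q.2 := by
    rw [continuous_iff_continuousAt]
    rintro ⟨h₀, m₀⟩
    have h1 : Filter.Tendsto (fun q : H × M => B q.1 (q.2 - m₀)) (𝓝 (h₀, m₀)) (𝓝 0) := by
      rw [hUA.tendsto_right_iff]
      intro k _
      have h2 : Filter.Tendsto (fun q : H × M => q.2 - m₀) (𝓝 (h₀, m₀)) (𝓝 0) := by
        have : Continuous fun q : H × M => q.2 - m₀ := by fun_prop
        simpa using this.tendsto (h₀, m₀)
      filter_upwards [h2 (hUM.mem_of_mem (i := k) trivial)] with q hq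
      exact hU _ k _ hq
    have h3 : Filter.Tendsto (fun q : H × M => B q.1 m₀) (𝓝 (h₀, m₀)) (𝓝 (B h₀ m₀)) :=
      ((hcont m₀).comp continuous_fst).tendsto (h₀, m₀)
    have h4 := h1.add h3
    rw [zero_add] at h4
    refine h4.congr fun q => ?_
    rw [← map_add, sub_add_cancel]
  let φ₁ : Additive H →+ (M →ₜ+ A) := AddMonoidHom.mk'
    (fun h => ⟨B h.toMul, hfc _⟩) fun x y => by
      ext m
      exact hmul _ _ m
  have hφ₁ : Function.Bijective φ₁ := by
    constructor
    · rw [injective_iff_map_eq_zero]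
      intro h hh
      exact congrArg Additive.ofMul (hinj h.toMul fun m => DFunLike.congr_fun hh m)
    · intro f
      obtain ⟨h, hh⟩ := hsurj f
      exact ⟨Additive.ofMul h, by ext m; exact DFunLike.congr_fun hh m⟩
  have hφ₁c : Continuous φ₁ := by
    refine ContinuousAddMonoidHom.continuous_of_continuous_uncurry _ ?_
    exact hjoint.comp ((continuous_toMul.comp continuous_fst).prodMk continuous_snd)
  let e₁ := AddEquiv.ofBijective φ₁ hφ₁
  let φ₂ : M →+ (Additive H →ₜ+ A) := AddMonoidHom.mk'
    (fun m => ⟨AddMonoidHom.mk' (fun h => B h.toMul m) fun x y => hmul _ _ m,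
      (hcont m).comp continuous_toMul⟩) fun x y => by
      ext h
      exact map_add (B h.toMul) x y
  have hφ₂ : Function.Bijective φ₂ := by
    constructor
    · rw [injective_iff_map_eq_zero]
      intro m hm
      exact hker' m fun h => DFunLike.congr_fun hm (Additive.ofMul h)
    · intro χ
      obtain ⟨m, hm⟩ := hsurj' (fun h => χ (Additive.ofMul h))
        (χ.continuous_toFun.comp continuous_ofMul) fun x y => map_add χ _ _
      exact ⟨m, by ext h; exact hm h.toMul⟩
  have hφ₂c : Continuous φ₂ := by
    refine ContinuousAddMonoidHom.continuous_of_continuous_uncurry _ ?_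
    exact hjoint.comp ((continuous_toMul.comp continuous_snd).prodMk continuous_fst)
  let e₂ := AddEquiv.ofBijective φ₂ hφ₂
  have he₂ : Continuous e₂.symm := by
    refine continuous_of_continuousAt_zero e₂.symm ?_
    rw [ContinuousAt, map_zero, hUM.tendsto_right_iff]
    intro k _
    have hopen : IsOpen (UA k : Set A) :=
      (UA k).isOpen_of_mem_nhds (hUA.mem_of_mem (i := k) trivial)
    -- Characters mapping all of the compact group H into the open subgroup `UA k` form an open set,
    -- and `hker` puts their preimages in `UM k`.
    have h1 := (ContinuousMap.isOpen_setOfPred_mapsTo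
      (isCompact_univ (X := Additive H)) hopen).preimage
      (ContinuousAddMonoidHom.isInducing_toContinuousMap (Additive H) A).continuous
    filter_upwards [h1.mem_nhds (fun h _ => (UA k).zero_mem)] with χ hχ
    refine hker k _ fun h => ?_
    have h2 : φ₂ (e₂.symm χ) = χ := e₂.apply_symm_apply χ
    have h3 : B h (e₂.symm χ) = χ (Additive.ofMul h) := DFunLike.congr_fun h2 (Additive.ofMul h)
    rw [h3]
    exact hχ (Set.mem_univ _)
  exact
    { mul_left := hmul
      add_right := fun h m m' => map_add (B h) m m'
      left_nondegenerate := hinj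
      right_nondegenerate := hker'
      continuous_of_hom := hfc
      left_equiv := ⟨{ e₁ with
        continuous_toFun := hφ₁c
        continuous_invFun :=
          (Continuous.homeoOfEquivCompactToT2 (f := e₁.toEquiv) hφ₁c).continuous_symm },
        fun _ _ => rfl⟩
      right_equiv := ⟨{ e₂ with
        continuous_toFun := hφ₂c
        continuous_invFun := he₂ }, fun _ _ => rfl⟩ }

/-! ### Filtrations and topologies on W_n(R) and W_n(R)/℘W_n(R). -/

section Quotients

variable {p : ℕ} [hp : Fact p.Prime] {n : ℕ∞} {R S : Type*} [CommRing R] [CommRing S]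

variable (p n R) in
/-- The image of `V^k W(R)` in `W_n(R)`. -/
def wittLenFil (k : ℕ) : AddSubgroup (WittLen p n R) :=
  (vIdeal p (k : ℕ∞) R).toAddSubgroup.map (Ideal.Quotient.mk (vIdeal p n R)).toAddMonoidHom

theorem wittLen_mk_eq_zero {x : WittVector p R} :
    (Ideal.Quotient.mk (vIdeal p n R)) x = 0 ↔ x ∈ vIdeal p n R :=
  Ideal.Quotient.eq_zero_iff_mem

/-- The minimum appears because V^k W + V^n W is the larger of the two ideals. -/
theorem mem_wittLenFil {k : ℕ} {x : WittVector p R} :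
    Ideal.Quotient.mk (vIdeal p n R) x ∈ wittLenFil p n R k ↔
      x ∈ vIdeal p (min (k : ℕ∞) n) R := by
  constructor
  · rintro ⟨y, hy, hxy⟩
    have h1 : y - x ∈ vIdeal p n R := Ideal.Quotient.eq.1 hxy
    rw [← sub_sub_cancel y x]
    exact sub_mem (vIdeal_anti (min_le_left _ _) hy) (vIdeal_anti (min_le_right _ _) h1)
  · intro hx
    rcases le_total (k : ℕ∞) n with h | h
    · rw [min_eq_left h] at hx
      exact ⟨x, hx, rfl⟩
    · rw [min_eq_right h] at hx
      rw [wittLen_mk_eq_zero.2 hx]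
      exact zero_mem _

open Topology in
theorem hasBasis_nhds_zero_wittLen :
    (𝓝 (0 : WittLen p n R)).HasBasis (fun _ => True)
      (fun k => (wittLenFil p n R k : Set (WittLen p n R))) := by
  have h1 := (vIdeal_basis p R).hasBasis_nhds_zero.map (Ideal.Quotient.mk (vIdeal p n R))
  have h2 : IsOpenMap (Ideal.Quotient.mk (vIdeal p n R)) :=
    (QuotientAddGroup.isOpenQuotientMap_mk (N := (vIdeal p n R).toAddSubgroup)).isOpenMap
  have h3 : Continuous (Ideal.Quotient.mk (vIdeal p n R)) :=
    (QuotientAddGroup.isOpenQuotientMap_mk (N := (vIdeal p n R).toAddSubgroup)).continuous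
  have h4 := h2.map_nhds_eq h3.continuousAt (x := 0)
  rw [map_zero] at h4
  rw [← h4]
  exact h1

instance : T2Space (WittLen p n R) := by
  refine IsTopologicalAddGroup.t2Space_of_zero_sep fun x hx => ?_
  obtain ⟨x, rfl⟩ := Ideal.Quotient.mk_surjective x
  rw [Ne, wittLen_mk_eq_zero] at hx
  have : ∃ k : ℕ, ¬ x ∈ vIdeal p (min (k : ℕ∞) n) R := by
    by_contra! h
    refine hx (mem_vIdeal_of_forall_natCast fun k hk => ?_)
    have := h k
    rwa [min_eq_left hk] at this
  obtain ⟨k, hk⟩ := this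
  exact ⟨_, hasBasis_nhds_zero_wittLen.mem_of_mem (i := k) trivial,
    fun h => hk (mem_wittLenFil.1 h)⟩

variable [CharP R p]

variable (p n R) in
/-- The quotient map `W(R) → W_n(R)/℘ W_n(R)`. -/
def mkWittMod : WittVector p R →+ WittModWp p n R :=
  (QuotientAddGroup.mk' (wp p n R).range).comp (Ideal.Quotient.mk (vIdeal p n R)).toAddMonoidHom

theorem mkWittMod_surjective : Function.Surjective (mkWittMod p n R) :=
  (QuotientAddGroup.mk'_surjective _).comp Ideal.Quotient.mk_surjective

theorem mkWittMod_eq_zero {c : WittVector p R} :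
    mkWittMod p n R c = 0 ↔ ∃ b, c - wittWp p R b ∈ vIdeal p n R := by
  have : mkWittMod p n R c = 0 ↔ Ideal.Quotient.mk (vIdeal p n R) c ∈ (wp p n R).range :=
    QuotientAddGroup.eq_zero_iff _
  rw [this]
  constructor
  · rintro ⟨b, hb⟩
    obtain ⟨b, rfl⟩ := Ideal.Quotient.mk_surjective b
    exact ⟨b, Ideal.Quotient.eq.1 hb.symm⟩
  · rintro ⟨b, hb⟩
    exact ⟨Ideal.Quotient.mk _ b, (Ideal.Quotient.eq.2 hb).symm⟩

theorem mkWittMod_wittWp (b : WittVector p R) : mkWittMod p n R (wittWp p R b) = 0 :=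
  mkWittMod_eq_zero.2 ⟨b, by simp⟩

variable (p n R) in
/-- The image of `V^k W(R)` in `W_n(R)/℘ W_n(R)`. -/
def wittModFil (k : ℕ) : AddSubgroup (WittModWp p n R) :=
  (vIdeal p (k : ℕ∞) R).toAddSubgroup.map (mkWittMod p n R)

theorem mkWittMod_mem_wittModFil {k : ℕ} {c b : WittVector p R}
    (h : c - wittWp p R b ∈ vIdeal p (min (k : ℕ∞) n) R) :
    mkWittMod p n R c ∈ wittModFil p n R k := by
  have h1 : mkWittMod p n R c = mkWittMod p n R (c - wittWp p R b) := by
    rw [map_sub, mkWittMod_wittWp, sub_zero]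
  rw [h1]
  rcases le_total (k : ℕ∞) n with h' | h'
  · rw [min_eq_left h'] at h
    exact ⟨_, h, rfl⟩
  · rw [min_eq_right h'] at h
    rw [mkWittMod_eq_zero.2 ⟨0, by simpa using h⟩]
    exact zero_mem _

open Topology in
theorem hasBasis_nhds_zero_wittMod :
    (𝓝 (0 : WittModWp p n R)).HasBasis (fun _ => True)
      (fun k => (wittModFil p n R k : Set (WittModWp p n R))) := by
  have h1 := (hasBasis_nhds_zero_wittLen (p := p) (n := n) (R := R)).map
    (QuotientAddGroup.mk : WittLen p n R → WittModWp p n R)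
  have hq := QuotientAddGroup.isOpenQuotientMap_mk (N := (wp p n R).range)
  have h4 := hq.isOpenMap.map_nhds_eq hq.continuous.continuousAt (x := 0)
  have h5 (k : ℕ) : (wittModFil p n R k : Set (WittModWp p n R)) =
      (QuotientAddGroup.mk : WittLen p n R → WittModWp p n R) '' wittLenFil p n R k := by
    ext m
    constructor
    · rintro ⟨c, hc, rfl⟩
      exact ⟨_, ⟨c, hc, rfl⟩, rfl⟩
    · rintro ⟨_, ⟨c, hc, rfl⟩, rfl⟩
      exact ⟨c, hc, rfl⟩
  simp only [h5]
  rw [h4] at h1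
  exact h1

/-- Homomorphisms `W(R) → W(𝔽_p)` that vanish on `℘ W(R)` induce homomorphisms
`W_n(R)/℘ W_n(R) → W_n(𝔽_p)`. -/
theorem exists_wittMod_lift {z : WittVector p R →+ WittVector p (ZMod p)}
    (hz : ∀ b, z (wittWp p R b) = 0) :
    ∃ f : WittModWp p n R →+ WittLen p n (ZMod p),
      ∀ c, f (mkWittMod p n R c) = Ideal.Quotient.mk _ (z c) := by
  let y : WittVector p R →+ WittLen p n (ZMod p) :=
    (Ideal.Quotient.mk (vIdeal p n (ZMod p))).toAddMonoidHom.comp z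
  have hy : (mkWittMod p n R).ker ≤ y.ker := by
    intro c hc
    obtain ⟨b, hb⟩ := mkWittMod_eq_zero.1 hc
    have := apply_mem_vIdeal_of_wittWp_eq_zero hz hb
    rw [map_sub, hz, sub_zero] at this
    exact wittLen_mk_eq_zero.2 this
  exact ⟨(mkWittMod p n R).liftOfSurjective mkWittMod_surjective ⟨y, hy⟩, fun c =>
    AddMonoidHom.liftOfRightInverse_comp_apply _ _ _ ⟨y, hy⟩ c⟩

theorem wittMod_hom_mem_wittLenFil (f : WittModWp p n R →+ WittLen p n (ZMod p)) (k : ℕ)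
    (m : WittModWp p n R) (hm : m ∈ wittModFil p n R k) : f m ∈ wittLenFil p n (ZMod p) k := by
  obtain ⟨c, hc, rfl⟩ := hm
  obtain ⟨y, b, rfl⟩ := exists_sub_pow_mul_mem_range hc
  obtain ⟨x, hx⟩ := Ideal.Quotient.mk_surjective (f (mkWittMod p n R y))
  have : (p : WittVector p R) ^ k * y = (p ^ k) • y := by simp
  rw [map_add, mkWittMod_wittWp, add_zero, this, map_nsmul, map_nsmul, ← hx, ← map_nsmul,
    mem_wittLenFil]
  refine vIdeal_anti (min_le_left _ _) ?_
  simpa using pow_mul_mem_vIdeal k x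

end Quotients

/-! ### From the lifted pairing to a perfect pairing. -/

section Main

variable {p : ℕ} [hp : Fact p.Prime] {n : ℕ∞} {K L : Type*} [Field K] [CharP K p]
  [Field L] [CharP L p] [Algebra K L] [IsGalois K L]

open Topology in
-- Finite n and n = ∞ share this argument; what remains specific to each is the kernel of π (`hker`)
-- and the surjectivity of φ₁ (`hsurj`).
theorem IsWittCocycle.hasPerfectWittPairing {H : Type*} [Group H] [TopologicalSpace H] [T2Space H]
    (hL : ∀ c : WittVector p K, ∃ a, wittWp p L a = WittVector.map (algebraMap K L) c)
    {D : Gal(L/K) → WittVector p K →+ WittVector p (ZMod p)} (hD : IsWittCocycle D)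
    (π : Gal(L/K) →* H) (hπ : Continuous π) (hπs : Function.Surjective π)
    (hker : ∀ g, π g = 1 ↔ ∀ c, D g c ∈ vIdeal p n (ZMod p))
    (hsurj : ∀ f : WittModWp p n K →+ WittLen p n (ZMod p),
      ∃ g, ∀ c, f (mkWittMod p n K c) = Ideal.Quotient.mk _ (D g c)) :
    HasPerfectWittPairing p n K L π := by
  have hlift (c : WittLen p n K) :
      ∃ a : WittLen p n L, wp p n L a = wittMap p n (algebraMap K L) c := by
    obtain ⟨c, rfl⟩ := Ideal.Quotient.mk_surjective c
    obtain ⟨a, ha⟩ := hL c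
    exact ⟨Ideal.Quotient.mk _ a, congrArg (Ideal.Quotient.mk (vIdeal p n L)) ha⟩
  refine ⟨hlift, ?_⟩
  choose β hβ using fun g => exists_wittMod_lift (n := n) (hD.apply_wittWp g)
  have hβmul (g h : Gal(L/K)) : β (g * h) = β g + β h := by
    refine AddMonoidHom.ext fun m => ?_
    obtain ⟨c, rfl⟩ := mkWittMod_surjective m
    rw [AddMonoidHom.add_apply, hβ, hβ, hβ, hD.mul_apply hL, map_add]
  have hβker (g : Gal(L/K)) : π g = 1 ↔ β g = 0 := by
    rw [hker]
    constructor
    · intro h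
      refine AddMonoidHom.ext fun m => ?_
      obtain ⟨c, rfl⟩ := mkWittMod_surjective m
      rw [hβ, wittLen_mk_eq_zero.2 (h c), AddMonoidHom.zero_apply]
    · intro h c
      rw [← wittLen_mk_eq_zero, ← hβ, h, AddMonoidHom.zero_apply]
  -- The choice of preimage is immaterial, as `hB` shows, since β vanishes on the kernel of π.
  let B : H → WittModWp p n K →+ WittLen p n (ZMod p) := fun h => β (Function.surjInv hπs h)
  have hB (g : Gal(L/K)) : B (π g) = β g := by
    have h1 : β (Function.surjInv hπs (π g) * g⁻¹) = 0 := by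
      rw [← hβker, map_mul, Function.surjInv_eq hπs, map_inv, mul_inv_cancel]
    have h2 := hβmul (Function.surjInv hπs (π g) * g⁻¹) g
    rwa [h1, zero_add, inv_mul_cancel_right] at h2
  have hBD (g : Gal(L/K)) (c : WittVector p K) :
      B (π g) (mkWittMod p n K c) = Ideal.Quotient.mk _ (D g c) := by rw [hB, hβ]
  have hpair : IsWittPairing p n K L π fun h m => B h m := by
    intro g a c hac
    obtain ⟨a, rfl⟩ := Ideal.Quotient.mk_surjective a
    obtain ⟨c, rfl⟩ := Ideal.Quotient.mk_surjective c
    have h1 : wittWp p L a - WittVector.map (algebraMap K L) c ∈ vIdeal p n L :=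
      Ideal.Quotient.eq.1 hac
    have h2 := Ideal.Quotient.eq.2 (hD.sub_mem_vIdeal_of_mem hL g h1)
    have h3 := congrArg (wittMap p n (ZMod.castHom (dvd_refl p) L)) (hBD g c)
    exact h3.trans h2
  have hcompact : CompactSpace H := hπs.compactSpace hπ
  refine ⟨fun h m => B h m, ⟨hpair, fun B' hB' => ?_⟩, ?_⟩
  · funext h m
    obtain ⟨g, rfl⟩ := hπs h
    obtain ⟨c, rfl⟩ := QuotientAddGroup.mk_surjective m
    obtain ⟨a, ha⟩ := hlift c
    have hinj : Function.Injective (wittMap p n (ZMod.castHom (dvd_refl p) L)) := by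
      rw [injective_iff_map_eq_zero]
      intro z hz
      obtain ⟨z, rfl⟩ := Ideal.Quotient.mk_surjective z
      have h1 : constMap p L z ∈ vIdeal p n L := wittLen_mk_eq_zero.1 hz
      exact wittLen_mk_eq_zero.2 (constMap_mem_vIdeal_iff.1 h1)
    exact hinj ((hB' g a c ha).trans (hpair g a c ha).symm)
  have hBmul (x y : H) : B (x * y) = B x + B y := by
    obtain ⟨g, rfl⟩ := hπs x
    obtain ⟨h, rfl⟩ := hπs y
    rw [← map_mul, hB, hB, hB, hβmul]
  have hmem {k : ℕ} {c : WittVector p K}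
      (h : ∀ x, B x (mkWittMod p n K c) ∈ wittLenFil p n (ZMod p) k) (g : Gal(L/K)) :
      D g c ∈ vIdeal p (min (k : ℕ∞) n) (ZMod p) := by
    rw [← mem_wittLenFil, ← hBD]
    exact h _
  refine isPerfectTopPairing_of_basis hasBasis_nhds_zero_wittMod hasBasis_nhds_zero_wittLen B
    (fun x y m => by rw [hBmul]; rfl) (fun m => ?_) wittMod_hom_mem_wittLenFil (fun x hx => ?_)
    (fun f => ?_) (fun k m h => ?_) (fun m h => ?_) (fun χ hχ hχmul => ?_)
  -- A continuous surjection from a compact to a Hausdorff space is a quotient map, so continuity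
  -- can be tested on Gal(L/K).
  · rw [(hπ.isClosedMap.isQuotientMap hπ hπs).continuous_iff]
    obtain ⟨c, rfl⟩ := mkWittMod_surjective m
    let γ : Additive Gal(L/K) →+ WittLen p n (ZMod p) :=
      AddMonoidHom.mk' (fun g => β g.toMul (mkWittMod p n K c)) fun x y => by
        rw [toMul_add, hβmul]; rfl
    have hγ : Continuous γ := by
      refine continuous_of_continuousAt_zero γ ?_
      rw [ContinuousAt, map_zero, hasBasis_nhds_zero_wittLen.tendsto_right_iff]
      intro k _
      have h1 := hD.eventually_apply_mem hL c k
      have h2 : Filter.Tendsto (Additive.toMul : Additive Gal(L/K) → Gal(L/K)) (𝓝 0) (𝓝 1) :=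
        continuous_toMul.tendsto _
      filter_upwards [h2.eventually h1] with g hg
      change β g.toMul (mkWittMod p n K c) ∈ wittLenFil p n (ZMod p) k
      rw [hβ, mem_wittLenFil]
      exact vIdeal_anti (min_le_left _ _) hg
    have h1 : (fun h => B h (mkWittMod p n K c)) ∘ π = fun g => γ (Additive.ofMul g) := by
      funext g
      exact DFunLike.congr_fun (hB g) _
    rw [h1]
    exact hγ.comp continuous_ofMul
  · obtain ⟨g, rfl⟩ := hπs x
    rw [hβker, ← hB]
    exact AddMonoidHom.ext hx
  · obtain ⟨g, hg⟩ := hsurj f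
    refine ⟨π g, AddMonoidHom.ext fun m => ?_⟩
    obtain ⟨c, rfl⟩ := mkWittMod_surjective m
    rw [hBD, hg]
  · obtain ⟨c, rfl⟩ := mkWittMod_surjective m
    obtain ⟨b, hb⟩ := hD.exists_sub_wittWp_mem hL (hmem h)
    exact mkWittMod_mem_wittModFil hb
  · obtain ⟨c, rfl⟩ := mkWittMod_surjective m
    refine mkWittMod_eq_zero.2 (hD.exists_sub_wittWp_mem hL fun g => ?_)
    rw [← wittLen_mk_eq_zero, ← hBD, h]
  · choose ψ hψ using fun g => Ideal.Quotient.mk_surjective (χ (π g))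
    suffices hc : ∃ c, ∀ g, D g c - ψ g ∈ vIdeal p n (ZMod p) by
      obtain ⟨c, hc⟩ := hc
      refine ⟨mkWittMod p n K c, fun x => ?_⟩
      obtain ⟨g, rfl⟩ := hπs x
      rw [hBD, ← hψ]
      exact Ideal.Quotient.eq.2 (hc g)
    refine hD.exists_eq_character hL ψ (fun g h => ?_) (fun k hk => ?_)
    · refine Ideal.Quotient.eq.1 ?_
      rw [map_add, hψ, hψ, hψ, map_mul, hχmul]
    · have h1 : χ 1 = 0 := by simpa using hχmul 1 1
      have h2 : Filter.Tendsto (fun g => χ (π g)) (𝓝 1) (𝓝 0) := by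
        have := (hχ.comp hπ).tendsto 1
        rwa [Function.comp_apply, map_one, h1] at this
      filter_upwards [h2 (hasBasis_nhds_zero_wittLen.mem_of_mem (i := k) trivial)] with g hg
      have h3 : χ (π g) ∈ wittLenFil p n (ZMod p) k := hg
      rwa [← hψ, mem_wittLenFil, min_eq_left hk] at h3

end Main

/-! ### The group G_p for compact G. -/

section ProP

variable (p : ℕ) (G : Type*) [CommGroup G]

theorem toProPQuotient_eq_one {g : G} :
    toProPQuotient p G g = 1 ↔ ∀ n, g ∈ powSubgroup p G n := by
  rw [← Subtype.val_inj, funext_iff]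
  exact forall_congr' fun n => QuotientGroup.eq_one_iff g

variable [TopologicalSpace G]

theorem continuous_toProPQuotient : Continuous (toProPQuotient p G) :=
  Continuous.subtype_mk (continuous_pi fun _ => continuous_quotient_mk') _

variable [IsTopologicalGroup G] [CompactSpace G] [T2Space G]

theorem t2Space_quotient_powSubgroup (n : ℕ) : T2Space (G ⧸ powSubgroup p G n) := by
  have := isClosed_powSubgroup p G n
  infer_instance

theorem t2Space_proPQuotient : T2Space (proPQuotient p G) := by
  have := t2Space_quotient_powSubgroup p G
  infer_instance

/-- The lifts of the successive components are nested nonempty closed sets in a compact group. -/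
theorem toProPQuotient_surjective : Function.Surjective (toProPQuotient p G) := by
  intro x
  have := t2Space_quotient_powSubgroup p G
  have hcl (i : ℕ) : IsClosed {g : G | (g : G ⧸ powSubgroup p G i) = x.1 i} :=
    isClosed_singleton.preimage continuous_quotient_mk'
  obtain ⟨g, hg⟩ := IsCompact.nonempty_iInter_of_sequence_nonempty_isCompact_isClosed
    (fun i : ℕ => {g : G | (g : G ⧸ powSubgroup p G i) = x.1 i})
    (fun i g hg => by
      have h1 := x.2 i (i + 1) i.le_succ
      have h2 : (g : G ⧸ powSubgroup p G (i + 1)) = x.1 (i + 1) := hg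
      rw [← h2] at h1
      exact h1)
    (fun i => QuotientGroup.mk_surjective (x.1 i)) (hcl 0).isCompact hcl
  exact ⟨g, Subtype.ext (funext fun i => Set.mem_iInter.1 hg i)⟩

end ProP

/-! ### Surjectivity of φ₁ and the left kernel. -/

section Kernels

variable {p : ℕ} [hp : Fact p.Prime] {K L : Type*} [Field K]
  [Field L] [CharP L p] [Algebra K L]

theorem exists_wittLen_embedding (p : ℕ) [Fact p.Prime] (n : ℕ) :
    ∃ j : WittLen p (n : ℕ∞) (ZMod p) →+ Additive ℂˣ, Function.Injective j ∧
      ∀ u : ℂˣ, u ^ p ^ n = 1 → ∃ x, j x = Additive.ofMul u := by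
  have : NeZero (p ^ n) := ⟨pow_ne_zero _ (Fact.out : p.Prime).ne_zero⟩
  obtain ⟨j, hj, hj'⟩ := exists_zmod_embedding (p ^ n)
  let e : WittLen p (n : ℕ∞) (ZMod p) ≃+ ZMod (p ^ n) :=
    (wittLenEquivTruncated p (ZMod p) n).toAddEquiv.trans
      (TruncatedWittVector.zmodEquivTrunc p n).symm.toAddEquiv
  refine ⟨j.comp e.toAddMonoidHom, hj.comp e.injective, fun u hu => ?_⟩
  obtain ⟨x, hx⟩ := hj' u hu
  obtain ⟨y, rfl⟩ := e.surjective x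
  exact ⟨y, hx⟩

theorem isAddTorsion_wittModWp [CharP K p] (n : ℕ) : IsAddTorsion (WittModWp p (n : ℕ∞) K) := by
  intro m
  obtain ⟨c, rfl⟩ := mkWittMod_surjective m
  refine isOfFinAddOrder_iff_nsmul_eq_zero.2 ⟨p ^ n, pow_pos hp.out.pos n, ?_⟩
  rw [← map_nsmul]
  refine mkWittMod_eq_zero.2 ⟨0, ?_⟩
  simpa using pow_mul_mem_vIdeal n c

instance nonarchimedeanGroup_gal : NonarchimedeanGroup Gal(L/K) where
  is_nonarchimedean U hU := by
    obtain ⟨E, hE, hEU⟩ := (krullTopology_mem_nhds_one_iff K L U).1 hU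
    exact ⟨⟨E.fixingSubgroup, E.fixingSubgroup_isOpen⟩, hEU⟩

namespace IsWittCocycle

variable {D : Gal(L/K) → WittVector p K →+ WittVector p (ZMod p)}

open Topology in
theorem exists_forall_eq [CharP K p] [IsGalois K L]
    (hL : ∀ c : WittVector p K, ∃ a, wittWp p L a = WittVector.map (algebraMap K L) c)
    (hD : IsWittCocycle D) (n : ℕ)
    (f : WittModWp p (n : ℕ∞) K →+ WittLen p (n : ℕ∞) (ZMod p)) :
    ∃ g, ∀ c, f (mkWittMod p n K c) = Ideal.Quotient.mk _ (D g c) := by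
  obtain ⟨j, hj, -⟩ := exists_wittLen_embedding p n
  choose β hβ using fun g => exists_wittMod_lift (n := n) (hD.apply_wittWp g)
  suffices h : ∃ g, β g = f by
    obtain ⟨g, rfl⟩ := h
    exact ⟨g, hβ g⟩
  refine exists_eq_of_nondegenerate j hj (isAddTorsion_wittModWp n) β (fun x y => ?_)
    (fun m a => ?_) (fun m hm => ?_) f
  · refine AddMonoidHom.ext fun m => ?_
    obtain ⟨c, rfl⟩ := mkWittMod_surjective m
    rw [AddMonoidHom.add_apply, hβ, hβ, hβ, hD.mul_apply hL, map_add]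
  · obtain ⟨c, rfl⟩ := mkWittMod_surjective m
    rw [← isOpen_compl_iff, isOpen_iff_mem_nhds]
    intro g hg
    have h1 := hD.eventually_apply_mem hL c n
    have h2 : Filter.Tendsto (fun x => g⁻¹ * x) (𝓝 g) (𝓝 1) := by
      simpa using (continuous_const_mul g⁻¹).tendsto g
    filter_upwards [h2.eventually h1] with x hx
    have h3 : β x (mkWittMod p n K c) = β g (mkWittMod p n K c) := by
      have h4 := hD.mul_apply hL g (g⁻¹ * x) c
      rw [mul_inv_cancel_left] at h4
      rw [hβ, hβ, h4, map_add, wittLen_mk_eq_zero.2 hx, add_zero]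
    change ¬ _ = _
    rw [h3]
    exact hg
  · obtain ⟨c, rfl⟩ := mkWittMod_surjective m
    refine mkWittMod_eq_zero.2 (hD.exists_sub_wittWp_mem hL fun g => ?_)
    rw [← wittLen_mk_eq_zero, ← hβ, hm]

open Topology in
-- The finite case gives, for each i, an element inducing f modulo V^i. These solution sets are
-- closed and nested, so they have a common point.
theorem exists_forall_eq_top [CharP K p] [IsGalois K L]
    (hL : ∀ c : WittVector p K, ∃ a, wittWp p L a = WittVector.map (algebraMap K L) c)
    (hD : IsWittCocycle D) (f : WittModWp p ⊤ K →+ WittLen p ⊤ (ZMod p)) :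
    ∃ g, ∀ c, f (mkWittMod p ⊤ K c) = Ideal.Quotient.mk _ (D g c) := by
  let z : WittVector p K →+ WittVector p (ZMod p) :=
    (wittLenTopEquiv p (ZMod p)).toAddEquiv.toAddMonoidHom.comp (f.comp (mkWittMod p ⊤ K))
  have hzf (c : WittVector p K) : f (mkWittMod p ⊤ K c) = Ideal.Quotient.mk _ (z c) :=
    ((wittLenTopEquiv p (ZMod p)).symm_apply_apply (f (mkWittMod p ⊤ K c))).symm
  have hz (b : WittVector p K) : z (wittWp p K b) = 0 := by
    simp [z, mkWittMod_wittWp]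
  have hcl (i : ℕ) : IsClosed {g | ∀ c, D g c - z c ∈ vIdeal p i (ZMod p)} := by
    rw [← isOpen_compl_iff, isOpen_iff_mem_nhds]
    intro g hg
    obtain ⟨c, hc⟩ := not_forall.1 hg
    have h1 := hD.eventually_apply_mem hL c i
    have h2 : Filter.Tendsto (fun x => g⁻¹ * x) (𝓝 g) (𝓝 1) := by
      simpa using (continuous_const_mul g⁻¹).tendsto g
    filter_upwards [h2.eventually h1] with x hx hxz
    apply hc
    have h4 := hD.mul_apply hL g (g⁻¹ * x) c
    rw [mul_inv_cancel_left] at h4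
    have h5 : D g c - z c = D x c - z c - D (g⁻¹ * x) c := by rw [h4]; ring
    rw [h5]
    exact sub_mem (hxz c) hx
  obtain ⟨g, hg⟩ := IsCompact.nonempty_iInter_of_sequence_nonempty_isCompact_isClosed
    (fun i : ℕ => {g | ∀ c, D g c - z c ∈ vIdeal p i (ZMod p)})
    (fun i g hg c => vIdeal_anti (by exact_mod_cast i.le_succ) (hg c))
    (fun i => by
      obtain ⟨fi, hfi⟩ := exists_wittMod_lift (n := i) hz
      obtain ⟨g, hg⟩ := exists_forall_eq hL hD i fi
      refine ⟨g, fun c => Ideal.Quotient.eq.1 ?_⟩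
      rw [← hg, hfi])
    (hcl 0).isCompact hcl
  refine ⟨g, fun c => ?_⟩
  rw [hzf]
  exact (Ideal.Quotient.eq.2
    (mem_vIdeal_of_forall_natCast fun k _ => Set.mem_iInter.1 hg k c)).symm

open Topology in
-- The converse is where the characters enter: one that is nontrivial at g and killed by p^n takes
-- values in W_n(𝔽_p) and equals D · c modulo V^n for some c, so D g c is not in V^n.
theorem mem_powSubgroup_iff [IsAbelianGalois K L]
    (hL : ∀ c : WittVector p K, ∃ a, wittWp p L a = WittVector.map (algebraMap K L) c)
    (hD : IsWittCocycle D) (n : ℕ) (g : Gal(L/K)) :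
    g ∈ powSubgroup p Gal(L/K) n ↔ ∀ c, D g c ∈ vIdeal p n (ZMod p) := by
  constructor
  · rintro ⟨h, rfl⟩ c
    have h1 (k : ℕ) : D (h ^ k) c = k • D h c := by
      induction k with
      | zero =>
        have := hD.mul_apply hL 1 1 c
        rw [mul_one] at this
        simpa using this
      | succ k ih => rw [pow_succ, hD.mul_apply hL, ih, succ_nsmul]
    change D (h ^ p ^ n) c ∈ _
    rw [h1]
    simpa using pow_mul_mem_vIdeal n (D h c)
  · intro hg
    by_contra hgn
    obtain ⟨χ, hχg, hχn, hχ1⟩ := exists_character_ne_one p n hgn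
    obtain ⟨j, hj, hj'⟩ := exists_wittLen_embedding p n
    have hx (x : Gal(L/K)) : ∃ z : WittVector p (ZMod p),
        j (Ideal.Quotient.mk _ z) = Additive.ofMul (χ x) := by
      obtain ⟨y, hy⟩ := hj' (χ x) (hχn x)
      obtain ⟨z, rfl⟩ := Ideal.Quotient.mk_surjective y
      exact ⟨z, hy⟩
    choose ψ hψ using hx
    have hψ0 (x : Gal(L/K)) : ψ x ∈ vIdeal p n (ZMod p) ↔ χ x = 1 := by
      rw [← wittLen_mk_eq_zero, ← hj.eq_iff, hψ, map_zero]
      exact Iff.rfl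
    obtain ⟨c, hc⟩ : ∃ c, ∀ x, D x c - ψ x ∈ vIdeal p n (ZMod p) := by
      refine hD.exists_eq_character hL ψ (fun x y => Ideal.Quotient.eq.1 (hj ?_))
        fun k hk => ?_
      · rw [map_add, map_add, hψ, hψ, hψ, map_mul]
        rfl
      · filter_upwards [hχ1] with x hx
        exact vIdeal_anti hk ((hψ0 x).2 hx)
    refine hχg ((hψ0 g).1 ?_)
    have := sub_mem (hg c) (hc g)
    rwa [sub_sub_cancel] at this

end IsWittCocycle

end Kernels

end ArtinSchreierWitt

end

theorem theorem3p3 (p : ℕ) [Fact p.Prime] (K Ksep : Type*) [Field K] [CharP K p]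
    [Field Ksep] [Algebra K Ksep] [IsSepClosure K Ksep] :
    (∀ n : ℕ, 1 ≤ n →
      ArtinSchreierWitt.HasPerfectWittPairing p (n : ℕ∞) K
        (ArtinSchreierWitt.maxAbelian K Ksep)
        (QuotientGroup.mk'
          (ArtinSchreierWitt.powSubgroup p Gal(ArtinSchreierWitt.maxAbelian K Ksep/K) n))) ∧
    ArtinSchreierWitt.HasPerfectWittPairing p ⊤ K
      (ArtinSchreierWitt.maxAbelian K Ksep)
      (ArtinSchreierWitt.toProPQuotient p Gal(ArtinSchreierWitt.maxAbelian K Ksep/K)) := by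
  open ArtinSchreierWitt in
  have hL := exists_wittWp_eq_maxAbelian p (K := K) (Ω := Ksep)
  obtain ⟨D, hD⟩ := exists_isWittCocycle hL
  constructor
  · intro n _
    have := t2Space_quotient_powSubgroup p Gal(maxAbelian K Ksep/K) n
    refine hD.hasPerfectWittPairing hL _ continuous_quotient_mk' (QuotientGroup.mk'_surjective _)
      (fun g => ?_) (hD.exists_forall_eq hL n)
    rw [← hD.mem_powSubgroup_iff hL]
    exact QuotientGroup.eq_one_iff g
  · have := t2Space_proPQuotient p Gal(maxAbelian K Ksep/K)
    refine hD.hasPerfectWittPairing hL _ (continuous_toProPQuotient p _)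
      (toProPQuotient_surjective p _) (fun g => ?_) (hD.exists_forall_eq_top hL)
    -- The kernel of G → G_p is the intersection of all p^i G, which corresponds to the V^i W(𝔽_p)
    -- having intersection 0.
    rw [toProPQuotient_eq_one]
    simp only [hD.mem_powSubgroup_iff hL]
    exact ⟨fun h c => mem_vIdeal_of_forall_natCast fun k _ => h k c,
      fun h k c => vIdeal_anti le_top (h c)⟩
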